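/- Let $d,n,l\ge 1$ be integers. For $y\in\mathbb R^n$ and $t=(t_1,\dots,t_n)\in\mathbb R^n$ with all $t_i\ge 0$ put $$\Lambda_y=\begin{pmatrix}1&y^{T}\\0&I_n\end{pmatrix}\mathbb Z^{n+1}\subset\mathbb R^{n+1},\qquad g_t=\operatorname{diag}\bigl(e^{t_1+\dots+t_n},e^{-t_1},\dots,e^{-t_n}\bigr),$$ and for a lattice $\Lambda\subset\mathbb R^{n+1}$ let $\delta(\Lambda)=\inf_{v\in\Lambda\setminus\{0\}}\|v\|$, where $\|v\|=\max_i|v_i|$. Write $|\cdot|$ for Lebesgue measure on $\mathbb R^d$. Let $U\subset\mathbb R^d$ be open, let $f:U\to\mathbb R^n$ be a $C^l$ map, and let $x_0\in U$ be such that $\mathbb R^n$ is spanned by the partial derivatives $\partial_\beta f(x_0)$ with $1\le|\beta|\le l$. Then there exist an open Euclidean ball $B\subset U$ centered at $x_0$ and constants $D,\rho>0$ such that for all $t_1,\dots,t_n\ge 0$ and all $0<\varepsilon\le\rho$, $$\bigl|\{x\in B:\ \delta(g_t\Lambda_{f(x)})<\varepsilon\}\bigr|\le D\left(\frac{\varepsilon}{\rho}\right)^{1/(dl)}|B|.$$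 -/

import Mathlib

open scoped Matrix

namespace KM

/-- The partial derivative `∂_{i 0} ∂_{i 1} ⋯ ∂_{i (k-1)} f (x)` of order `k`: the `k`-th derivative
of `f` at `x`, evaluated at the standard basis vectors `e_{i 0}, …, e_{i (k-1)}` of `ℝ^d`. -/
noncomputable def partialDeriv {d n k : ℕ} (i : Fin k → Fin d)
    (f : EuclideanSpace ℝ (Fin d) → (Fin n → ℝ)) (x : EuclideanSpace ℝ (Fin d)) : Fin n → ℝ :=
  iteratedFDeriv ℝ k f x (fun j => EuclideanSpace.single (i j) (1 : ℝ))

/-- `ℝ^n` is spanned by the partial derivatives of `f` at `x` of orders `1, …, l`.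
(The value `f x` itself, of order zero, is not counted.) -/
def SpannedByPartials {d n : ℕ} (l : ℕ)
    (f : EuclideanSpace ℝ (Fin d) → (Fin n → ℝ)) (x : EuclideanSpace ℝ (Fin d)) : Prop :=
  Submodule.span ℝ
    {v : Fin n → ℝ | ∃ k : ℕ, 1 ≤ k ∧ k ≤ l ∧ ∃ i : Fin k → Fin d, v = partialDeriv i f x} = ⊤

/-- The lattice `ℤ^k` in `ℝ^k`. -/
def intLattice (k : ℕ) : AddSubgroup (Fin k → ℝ) :=
  ((Int.castAddHom ℝ).compLeft (Fin k)).range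

/-- The image `A Λ` of a subgroup `Λ` of `ℝ^k` under a matrix `A`. -/
noncomputable def matAct {k : ℕ} (A : Matrix (Fin k) (Fin k) ℝ) (Λ : AddSubgroup (Fin k → ℝ)) :
    AddSubgroup (Fin k → ℝ) :=
  Λ.map (Matrix.mulVecLin A).toAddMonoidHom

/-- The unipotent matrix with rows `(1, y)` and `(0, I_n)`. -/
def uMat {n : ℕ} (y : Fin n → ℝ) : Matrix (Fin (n + 1)) (Fin (n + 1)) ℝ :=
  Matrix.of (Fin.cons (Fin.cons 1 y : Fin (n + 1) → ℝ)
    (fun i : Fin n => (Fin.cons 0 ((1 : Matrix (Fin n) (Fin n) ℝ) i) : Fin (n + 1) → ℝ)))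

/-- The lattice `Λ_y = u_y ℤ^{n+1}`. -/
noncomputable def latticeOf {n : ℕ} (y : Fin n → ℝ) : AddSubgroup (Fin (n + 1) → ℝ) :=
  matAct (uMat y) (intLattice (n + 1))

/-- `g_t = diag(e^{t_1 + ⋯ + t_n}, e^{-t_1}, …, e^{-t_n})`. -/
noncomputable def gMat {n : ℕ} (t : Fin n → ℝ) : Matrix (Fin (n + 1)) (Fin (n + 1)) ℝ :=
  Matrix.diagonal (Fin.cons (Real.exp (∑ i, t i)) (fun i => Real.exp (-t i)) : Fin (n + 1) → ℝ)

/-- `δ(Λ)`, the infimum of `‖v‖` over the nonzero `v ∈ Λ`, where `‖·‖` is the maximum norm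
(the norm of the type `Fin k → ℝ`). -/
noncomputable def delta {k : ℕ} (Λ : AddSubgroup (Fin k → ℝ)) : ℝ :=
  sInf {r : ℝ | ∃ v ∈ Λ, v ≠ 0 ∧ r = ‖v‖}

end KM

/-!
The proof follows the method of Kleinbock and Margulis for quantitative nondivergence, in a form
adapted to the lattices `Λ_y`.

*Good functions.* A function is `(C, α)`-good if on every ball the proportion of points where it
is `< ε` is at most `C (ε / M) ^ α`, `M` being any positive value it reaches on the ball. On an
interval where the `k`-th derivative is bounded and bounded away from `0`, this holds with
exponent `1 / k`, by Lagrange interpolation at separated points of the sublevel set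
(`volume_sublevel_Ioo_le`). In dimension `d`, moving from a point with a large value to an
arbitrary point by changing one coordinate at a time, and applying Fubini to the step at which the
function drops by a factor `(ε / M) ^ (1 / d)`, gives the exponent `1 / (d k)`
(`volume_sublevel_cube_le`). The derivatives have to be bounded below in the directions of a basis
of `ℝ^d`. For a nonzero combination `∑ c_i f_i`, the spanning hypothesis gives a nonzero
derivative of some order `k` with `1 ≤ k ≤ l` at `x₀`; it is a symmetric form, so by polarization
the corresponding pure derivative is nonzero for a nonempty open set of directions, which
contains a basis. Compactness of the unit sphere of coefficients makes all `c₀ + ∑ c_i f_i` good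
near `x₀` with the same constants (`exists_goodNear_affine`), and gives a uniform lower bound for
their suprema on a ball (`exists_lower_bound_affine`).

*Nondivergence.* Let `ψ_W x` be the covolume of `g_t u_{f x} (W ∩ ℤ^{n+1})` for a nonzero rational
subspace `W`, measured by the largest minor of the image under `g_t u_{f x}` of a lattice basis.
Each minor is a constant or a multiple of a combination of `1, f_1, …, f_n`, hence good; and some
minor is a combination with integer coefficients, not all zero, multiplied by a factor `≥ 1`, so
that `ψ_W` reaches a fixed value `ρ` on the ball (`exists_le_covol`). By induction on the length
of chains and the Vitali covering lemma, most points `x` of the ball are marked: there is a chain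
of subspaces with `ψ_W x < ρ` such that every `W` comparable with the chain has `ε ≤ ψ_W x`
(`volume_not_marked_le`). At a marked point no nonzero lattice vector is shorter than `ε`: compare
the largest member of the chain that does not contain the vector with the subspace obtained by
adjoining it (`le_norm_of_marked`).
-/

namespace KM

open MeasureTheory Set Filter Topology

/-! ### Sublevel sets on an interval -/

/-- Iterated Rolle: if `F 0` has `k + 1` zeros in an interval and `F (j + 1)` is the derivative of
`F j`, then `F k` has a zero there. -/
lemma exists_zero_of_strictMono_zeros {a b : ℝ} (k : ℕ) (F : ℕ → ℝ → ℝ)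
    (hF : ∀ j < k, ∀ x ∈ Ioo a b, HasDerivAt (F j) (F (j + 1) x) x)
    (z : Fin (k + 1) → ℝ) (hz : StrictMono z) (hzI : ∀ i, z i ∈ Ioo a b)
    (h0 : ∀ i, F 0 (z i) = 0) : ∃ ξ ∈ Ioo a b, F k ξ = 0 := by
  induction k generalizing F with
  | zero => exact ⟨z 0, hzI 0, h0 0⟩
  | succ k ih =>
    have key : ∀ i : Fin (k + 1), ∃ w ∈ Ioo (z i.castSucc) (z i.succ), F 1 w = 0 := by
      intro i
      have hsub : Icc (z i.castSucc) (z i.succ) ⊆ Ioo a b := fun x hx =>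
        ⟨(hzI _).1.trans_le hx.1, hx.2.trans_lt (hzI _).2⟩
      refine exists_hasDerivAt_eq_zero (f := F 0) (hz i.castSucc_lt_succ) ?_ ?_ ?_
      · exact fun x hx => (hF 0 (by omega) x (hsub hx)).continuousAt.continuousWithinAt
      · rw [h0, h0]
      · exact fun x hx => hF 0 (by omega) x (hsub (Ioo_subset_Icc_self hx))
    choose w hw hw0 using key
    refine ih (fun j => F (j + 1)) (fun j hj x hx => hF (j + 1) (by omega) x hx) w ?_ ?_ hw0
    · rw [Fin.strictMono_iff_lt_succ]
      intro i
      exact (hw _).2.trans_le (by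
        have := (hw i.succ).1.le
        rw [← Fin.succ_castSucc] at this
        exact this) |>.trans_le le_rfl
    · exact fun i => ⟨(hzI _).1.trans (hw i).1, (hw i).2.trans (hzI _).2⟩

/-- Iterated Rolle for an unordered set of zeros. -/
lemma exists_zero_of_finset_zeros {a b : ℝ} {k : ℕ} {F : ℕ → ℝ → ℝ}
    (hF : ∀ j < k, ∀ x ∈ Ioo a b, HasDerivAt (F j) (F (j + 1) x) x)
    (s : Finset ℝ) (hs : s.card = k + 1) (hsI : ∀ x ∈ s, x ∈ Ioo a b)
    (h0 : ∀ x ∈ s, F 0 x = 0) : ∃ ξ ∈ Ioo a b, F k ξ = 0 :=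
  exists_zero_of_strictMono_zeros k F hF (s.orderEmbOfFin hs) (s.orderEmbOfFin hs).strictMono
    (fun i => hsI _ (s.orderEmbOfFin_mem hs i)) (fun i => h0 _ (s.orderEmbOfFin_mem hs i))

open Polynomial in
/-- The error term of Lagrange interpolation at the `k` points of `s`. -/
lemma exists_interpolate_error {a b : ℝ} {k : ℕ} {F : ℕ → ℝ → ℝ}
    (hF : ∀ j < k, ∀ x ∈ Ioo a b, HasDerivAt (F j) (F (j + 1) x) x)
    (s : Finset ℝ) (hs : s.card = k) (hsI : ∀ x ∈ s, x ∈ Ioo a b) {y : ℝ} (hy : y ∈ Ioo a b) :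
    ∃ ξ ∈ Ioo a b, F 0 y - (Lagrange.interpolate s id (F 0)).eval y =
      F k ξ / k.factorial * ∏ x ∈ s, (y - x) := by
  have hinj : Set.InjOn (id : ℝ → ℝ) (s : Set ℝ) := Function.injective_id.injOn
  by_cases hys : y ∈ s
  · refine ⟨y, hy, ?_⟩
    have := Lagrange.eval_interpolate_at_node (F 0) hinj hys
    simp only [id] at this
    rw [this, Finset.prod_eq_zero hys (sub_self y)]
    simp
  set P := Lagrange.interpolate s id (F 0) with hP
  have hprod : ∏ x ∈ s, (y - x) ≠ 0 :=
    Finset.prod_ne_zero_iff.2 fun x hx h => hys (by rwa [sub_eq_zero.1 h])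
  -- `K` makes `F 0 - Q` vanish at `y`, besides the points of `s`
  set K := (F 0 y - P.eval y) / ∏ x ∈ s, (y - x) with hK
  set Q : ℝ[X] := P + C K * Lagrange.nodal s id with hQ
  have hQdeg : Q.natDegree ≤ k := by
    refine (natDegree_add_le _ _).trans (max_le ?_ ?_)
    · rw [natDegree_le_iff_degree_le, ← hs]
      exact (Lagrange.degree_interpolate_lt _ hinj).le
    · refine (natDegree_C_mul_le _ _).trans ?_
      rw [Lagrange.natDegree_nodal, hs]
  have hQcoeff : Q.coeff k = K := by
    rw [hQ, coeff_add, coeff_C_mul, coeff_eq_zero_of_degree_lt, zero_add]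
    · have h1 : (Lagrange.nodal s (id : ℝ → ℝ)).coeff k = 1 := by
        have := (Lagrange.nodal_monic (s := s) (v := (id : ℝ → ℝ))).coeff_natDegree
        rwa [Lagrange.natDegree_nodal, hs] at this
      rw [h1, mul_one]
    · rw [← hs]
      exact Lagrange.degree_interpolate_lt _ hinj
  have hQk : derivative^[k] Q = C (k.factorial * K) := by
    have hdeg : (derivative^[k] Q).natDegree ≤ 0 := by
      refine (natDegree_iterate_derivative Q k).trans ?_
      omega
    rw [eq_C_of_natDegree_le_zero hdeg, coeff_iterate_derivative, zero_add, hQcoeff,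
      Nat.descFactorial_self, nsmul_eq_mul]
  have hQeval : ∀ x, Q.eval x = P.eval x + K * ∏ t ∈ s, (x - t) := by
    intro x
    simp [hQ, Lagrange.eval_nodal]
  obtain ⟨ξ, hξ, h⟩ := exists_zero_of_finset_zeros (k := k)
    (F := fun j x => F j x - (derivative^[j] Q).eval x) (a := a) (b := b)
    (fun j hj x hx => by
      refine (hF j hj x hx).sub ?_
      rw [Function.iterate_succ_apply']
      exact Polynomial.hasDerivAt _ _)
    (insert y s) (by rw [Finset.card_insert_of_notMem hys, hs])
    (fun x hx => by
      rcases Finset.mem_insert.1 hx with rfl | hx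
      exacts [hy, hsI x hx])
    (fun x hx => by
      simp only [Function.iterate_zero, id]
      rw [hQeval]
      rcases Finset.mem_insert.1 hx with rfl | hx
      · rw [hK]; field_simp; ring
      · have := Lagrange.eval_interpolate_at_node (F 0) hinj hx
        simp only [id] at this
        rw [hP, this, Finset.prod_eq_zero hx (sub_self x)]
        ring)
  refine ⟨ξ, hξ, ?_⟩
  simp only [hQk, eval_C] at h
  have hf : (k.factorial : ℝ) ≠ 0 := by positivity
  rw [sub_eq_zero.1 h, mul_div_cancel_left₀ _ hf, hK]
  field_simp

/-- Bound for the Lagrange interpolation polynomial at `δ`-separated nodes. -/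
lemma abs_eval_interpolate_le {s : Finset ℝ} {φ : ℝ → ℝ} {ε δ : ℝ} (hδ : 0 < δ)
    (hsep : ∀ x ∈ s, ∀ x' ∈ s, x ≠ x' → δ ≤ |x - x'|) (hφ : ∀ x ∈ s, |φ x| ≤ ε) (y : ℝ) :
    |(Lagrange.interpolate s id φ).eval y| ≤
      ∑ x ∈ s, ε * ∏ x' ∈ s.erase x, (|y - x'| / δ) := by
  rw [Lagrange.interpolate_apply, Polynomial.eval_finsetSum]
  refine (Finset.abs_sum_le_sum_abs _ _).trans (Finset.sum_le_sum fun x hx => ?_)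
  rw [Polynomial.eval_mul, Polynomial.eval_C, abs_mul]
  refine mul_le_mul (hφ x hx) ?_ (abs_nonneg _) ((abs_nonneg _).trans (hφ x hx))
  rw [Lagrange.basis, Polynomial.eval_prod, Finset.abs_prod]
  refine Finset.prod_le_prod (fun _ _ => abs_nonneg _) fun x' hx' => ?_
  have hx'' := Finset.mem_erase.1 hx'
  simp only [Lagrange.basisDivisor, id, Polynomial.eval_mul, Polynomial.eval_C,
    Polynomial.eval_sub, Polynomial.eval_X, abs_mul, abs_inv]
  rw [div_eq_inv_mul]
  gcongr
  exact hsep x hx x' hx''.2 hx''.1.symm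

/-- If `|φ| ≤ ε` at `k + 1` points of an interval of length `w` that are `δ`-separated, and the
`k`-th derivative of `φ` is of size between `A₁` and `A₂`, then `φ` is bounded on the interval. -/
lemma abs_le_of_separated {a b : ℝ} {k : ℕ} (hk : 1 ≤ k) {F : ℕ → ℝ → ℝ}
    (hF : ∀ j < k, ∀ x ∈ Ioo a b, HasDerivAt (F j) (F (j + 1) x) x)
    {A₁ A₂ : ℝ} (hA₁ : 0 < A₁) (hFk : ∀ x ∈ Ioo a b, A₁ ≤ |F k x| ∧ |F k x| ≤ A₂)
    {s : Finset ℝ} (hs : s.card = k + 1) (hsI : ∀ x ∈ s, x ∈ Ioo a b) {ε δ : ℝ} (hδ : 0 < δ)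
    (hsep : ∀ x ∈ s, ∀ x' ∈ s, x ≠ x' → δ ≤ |x - x'|) (hφ : ∀ x ∈ s, |F 0 x| ≤ ε)
    {y : ℝ} (hy : y ∈ Ioo a b) :
    |F 0 y| ≤ (k + 1) * (A₂ / A₁ + 1) * ε * ((b - a) / δ) ^ k := by
  have hlen : ∀ x ∈ Ioo a b, ∀ x' ∈ Ioo a b, |x - x'| ≤ b - a := fun x hx x' hx' => by
    rw [abs_le]; constructor <;> linarith [hx.1, hx.2, hx'.1, hx'.2]
  obtain ⟨x₀, hx₀⟩ : s.Nonempty := Finset.card_pos.1 (by omega)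
  have hε : 0 ≤ ε := (abs_nonneg _).trans (hφ x₀ hx₀)
  set t := s.erase x₀ with ht
  have htcard : t.card = k := by rw [ht, Finset.card_erase_of_mem hx₀, hs]; rfl
  have hts : ∀ x ∈ t, x ∈ s := fun x hx => Finset.mem_of_mem_erase hx
  have htI : ∀ x ∈ t, x ∈ Ioo a b := fun x hx => hsI x (hts x hx)
  have hw : δ ≤ b - a := by
    obtain ⟨x₁, hx₁⟩ : t.Nonempty := Finset.card_pos.1 (by omega)
    exact (hsep x₀ hx₀ x₁ (hts _ hx₁) (Finset.ne_of_mem_erase hx₁).symm).trans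
      (hlen _ (hsI _ hx₀) _ (htI _ hx₁))
  have hint := abs_eval_interpolate_le (s := t) (φ := F 0) hδ
    (fun x hx x' hx' => hsep x (hts x hx) x' (hts x' hx')) (fun x hx => hφ x (hts x hx))
  have hkf : (0 : ℝ) < k.factorial := by positivity
  have hwδ : 1 ≤ (b - a) / δ := (one_le_div hδ).2 hw
  -- comparison at the remaining node bounds the `k`-th derivative
  have hA : A₁ / k.factorial ≤ (k + 1) * ε / δ ^ k := by
    obtain ⟨ξ, hξ, he⟩ := exists_interpolate_error hF t htcard htI (hsI x₀ hx₀)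
    have hfac : ∀ x ∈ t, 1 ≤ |x₀ - x| / δ := fun x hx =>
      (one_le_div hδ).2 (hsep x₀ hx₀ x (hts x hx) (Finset.ne_of_mem_erase hx).symm)
    set p := ∏ x ∈ t, (|x₀ - x| / δ) with hp
    have hp1 : 1 ≤ p := by
      rw [hp]
      exact Finset.prod_induction _ (fun z : ℝ => 1 ≤ z) (fun _ _ => one_le_mul_of_one_le_of_one_le)
        le_rfl hfac
    have h1 : |(Lagrange.interpolate t id (F 0)).eval x₀| ≤ k * (ε * p) := by
      refine (hint x₀).trans ((Finset.sum_le_card_nsmul _ _ (ε * p) fun x hx => ?_).trans ?_)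
      · refine mul_le_mul_of_nonneg_left ?_ hε
        rw [hp, ← Finset.mul_prod_erase _ _ hx]
        refine le_mul_of_one_le_left (Finset.prod_nonneg fun _ _ => by positivity) (hfac x hx)
      · rw [htcard, nsmul_eq_mul]
    have h2 : |F k ξ| / k.factorial * (p * δ ^ k) ≤ (k + 1) * ε * p := by
      have : |F k ξ / k.factorial * ∏ x ∈ t, (x₀ - x)| = |F k ξ| / k.factorial * (p * δ ^ k) := by
        rw [abs_mul, abs_div, Nat.abs_cast, Finset.abs_prod, hp, Finset.prod_div_distrib,
          Finset.prod_const, htcard, div_mul_cancel₀ _ (by positivity)]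
      rw [← this, ← he]
      refine (abs_sub _ _).trans ?_
      have := hφ x₀ hx₀
      nlinarith [mul_nonneg hε (sub_nonneg.2 hp1)]
    rw [le_div_iff₀ (by positivity)]
    refine le_of_mul_le_mul_right ?_ (zero_lt_one.trans_le hp1)
    refine le_trans ?_ h2
    have := (hFk ξ hξ).1
    calc A₁ / k.factorial * δ ^ k * p ≤ |F k ξ| / k.factorial * δ ^ k * p := by gcongr
      _ = _ := by ring
  obtain ⟨ξ, hξ, he⟩ := exists_interpolate_error hF t htcard htI hy
  have h1 : |(Lagrange.interpolate t id (F 0)).eval y| ≤ k * (ε * ((b - a) / δ) ^ k) := by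
    refine (hint y).trans ((Finset.sum_le_card_nsmul _ _ (ε * ((b - a) / δ) ^ k)
      fun x hx => ?_).trans ?_)
    · refine mul_le_mul_of_nonneg_left ?_ hε
      refine (Finset.prod_le_prod (g := fun _ => (b - a) / δ) (fun _ _ => by positivity)
        fun x' hx' => ?_).trans ?_
      · have := hlen y hy x' (htI x' (Finset.mem_of_mem_erase hx'))
        gcongr
      · rw [Finset.prod_const]
        exact pow_le_pow_right₀ hwδ
          (by rw [Finset.card_erase_of_mem hx, htcard]; omega)
    · rw [htcard, nsmul_eq_mul]
  have h2 : |∏ x ∈ t, (y - x)| ≤ (b - a) ^ k := by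
    rw [Finset.abs_prod, ← htcard, ← Finset.prod_const]
    exact (Finset.prod_le_prod (fun _ _ => abs_nonneg _)
      fun x hx => hlen y hy x (htI x hx))
  have hba : 0 < b - a := hδ.trans_le hw
  have hA₂ : 0 ≤ A₂ := (abs_nonneg _).trans (hFk ξ hξ).2
  have h3 : |F k ξ / k.factorial * ∏ x ∈ t, (y - x)| ≤
      (k + 1) * (A₂ / A₁) * ε * ((b - a) / δ) ^ k := by
    rw [abs_mul, abs_div, Nat.abs_cast]
    calc |F k ξ| / k.factorial * |∏ x ∈ t, (y - x)| ≤ A₂ / k.factorial * (b - a) ^ k := by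
          have := (hFk ξ hξ).2
          gcongr
      _ = A₂ / A₁ * (A₁ / k.factorial) * (b - a) ^ k := by field_simp
      _ ≤ A₂ / A₁ * ((k + 1) * ε / δ ^ k) * (b - a) ^ k := by gcongr
      _ = _ := by rw [div_pow]; ring
  have h4 : |F 0 y| ≤ |F k ξ / k.factorial * ∏ x ∈ t, (y - x)| +
      |(Lagrange.interpolate t id (F 0)).eval y| := by
    rw [← he]
    simpa using abs_add_le (F 0 y - (Lagrange.interpolate t id (F 0)).eval y)
      ((Lagrange.interpolate t id (F 0)).eval y)
  have h5 : (0 : ℝ) ≤ ε * ((b - a) / δ) ^ k := by positivity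
  nlinarith

/-- A set of reals of large measure contains many separated points. -/
lemma exists_separated_finset {E : Set ℝ} {δ : ℝ} (hδ : 0 < δ) (m : ℕ)
    (hE : ENNReal.ofReal (2 * m * δ) < volume E) :
    ∃ s : Finset ℝ, s.card = m + 1 ∧ (∀ x ∈ s, x ∈ E) ∧
      ∀ x ∈ s, ∀ x' ∈ s, x ≠ x' → δ ≤ |x - x'| := by
  induction m with
  | zero =>
    obtain ⟨x, hx⟩ : E.Nonempty := by
      by_contra h
      rw [not_nonempty_iff_eq_empty.1 h] at hE
      simp at hE
    refine ⟨{x}, by simp, by simpa, ?_⟩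
    intro y hy z hz hyz
    simp only [Finset.mem_singleton] at hy hz
    exact absurd (hy.trans hz.symm) hyz
  | succ m ih =>
    obtain ⟨s, hs, hsE, hsep⟩ := ih (lt_of_le_of_lt (ENNReal.ofReal_le_ofReal (by
      push_cast; nlinarith)) hE)
    obtain ⟨y, hy, hys⟩ : ∃ y ∈ E, y ∉ ⋃ x ∈ s, Metric.ball x δ := by
      by_contra! h
      refine absurd hE (not_lt.2 ?_)
      calc volume E ≤ volume (⋃ x ∈ s, Metric.ball x δ) := measure_mono h
        _ ≤ ∑ x ∈ s, volume (Metric.ball x δ) := measure_biUnion_finset_le _ _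
        _ = ENNReal.ofReal (2 * (m + 1 : ℕ) * δ) := by
          simp only [Real.volume_ball, Finset.sum_const, hs, nsmul_eq_mul]
          rw [← ENNReal.ofReal_natCast, ← ENNReal.ofReal_mul (by positivity)]
          congr 1; ring
    simp only [mem_iUnion, Metric.mem_ball, not_exists, not_lt, Real.dist_eq] at hys
    have hyn : y ∉ s := fun h => by have := hys y h; simp at this; linarith
    refine ⟨insert y s, by rw [Finset.card_insert_of_notMem hyn, hs], ?_, ?_⟩
    · intro x hx
      rcases Finset.mem_insert.1 hx with rfl | hx
      exacts [hy, hsE x hx]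
    · intro x hx x' hx' hne
      rcases Finset.mem_insert.1 hx with rfl | hxs <;>
        rcases Finset.mem_insert.1 hx' with rfl | hxs'
      · exact absurd rfl hne
      · exact hys x' hxs'
      · rw [abs_sub_comm]; exact hys x hxs
      · exact hsep x hxs x' hxs' hne

/-- Sublevel set estimate on an interval, relative to the size of the function. -/
lemma volume_sublevel_Ioo_le {a b : ℝ} {k : ℕ} (hk : 1 ≤ k) {F : ℕ → ℝ → ℝ}
    (hF : ∀ j < k, ∀ x ∈ Ioo a b, HasDerivAt (F j) (F (j + 1) x) x)
    {A₁ A₂ : ℝ} (hA₁ : 0 < A₁) (hFk : ∀ x ∈ Ioo a b, A₁ ≤ |F k x| ∧ |F k x| ≤ A₂)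
    {ε M : ℝ} (hε : 0 < ε) (hM : 0 < M) {y : ℝ} (hy : y ∈ Ioo a b) (hMy : M ≤ |F 0 y|) :
    volume {x ∈ Ioo a b | |F 0 x| < ε} ≤
      ENNReal.ofReal (4 * k * ((k + 1) * (A₂ / A₁ + 1)) * (ε / M) ^ ((1 : ℝ) / k) * (b - a)) := by
  have hba : 0 < b - a := by linarith [hy.1, hy.2]
  have hA₂ : 0 ≤ A₂ := (abs_nonneg _).trans (hFk y hy).2
  set C := (k + 1) * (A₂ / A₁ + 1) with hC
  have hkR : (1 : ℝ) ≤ k := by exact_mod_cast hk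
  have hC1 : 1 ≤ C := by
    have : 0 ≤ A₂ / A₁ := by positivity
    rw [hC]; nlinarith
  set τ := (ε / M) ^ ((1 : ℝ) / k) with hτ
  have hτ0 : 0 < τ := by positivity
  have hτk : τ ^ k = ε / M := by
    rw [hτ, one_div, Real.rpow_inv_natCast_pow (by positivity) (by omega)]
  by_contra! hcon
  set δ := 2 * C * τ * (b - a) with hδ
  obtain ⟨s, hs, hsE, hsep⟩ := exists_separated_finset (E := {x ∈ Ioo a b | |F 0 x| < ε}) (δ := δ)
    (by positivity) k (by
      convert hcon using 2
      rw [hδ]; ring)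
  have hb := abs_le_of_separated hk hF hA₁ hFk hs (fun x hx => (hsE x hx).1) (by positivity) hsep
    (fun x hx => (hsE x hx).2.le) hy
  rw [← hC] at hb
  have h1 : (b - a) / δ = (2 * C * τ)⁻¹ := by rw [hδ]; field_simp
  rw [h1, inv_pow, mul_pow, hτk] at hb
  have h2 : 2 * C ≤ (2 * C) ^ k := le_self_pow₀ (by linarith) (by omega)
  have h3 : C * ε * ((2 * C) ^ k * (ε / M))⁻¹ = C / (2 * C) ^ k * M := by field_simp
  rw [h3] at hb
  have h4 : C / (2 * C) ^ k ≤ 1 / 2 := by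
    rw [div_le_iff₀ (by positivity)]; linarith
  nlinarith

/-! ### Sublevel sets in several variables and good functions -/

/-- Fubini for a subset of a cube: if all its sections in the direction `j` have measure at most
`m`, then its measure is at most `m` times that of the face of the cube. -/
lemma volume_le_of_sections {d : ℕ} {w : ℝ} (hw : 0 < w) (a : Fin (d + 1) → ℝ)
    {A : Set (Fin (d + 1) → ℝ)} (hA : MeasurableSet A)
    (hAQ : A ⊆ univ.pi fun i => Ioo (a i) (a i + w)) (j : Fin (d + 1)) (m : ENNReal)
    (hm : ∀ p ∈ univ.pi fun i => Ioo (a i) (a i + w),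
      volume {s : ℝ | Function.update p j s ∈ A} ≤ m) :
    volume A ≤ m * ENNReal.ofReal w ^ d := by
  have hmp := (volume_preserving_piFinSuccAbove (fun _ : Fin (d + 1) => ℝ) j).symm
  rw [← hmp.measure_preimage_equiv, Measure.volume_eq_prod,
    Measure.prod_apply_symm (hmp.measurable hA)]
  set Q' : Set (Fin d → ℝ) := univ.pi fun i => Ioo (a (j.succAbove i)) (a (j.succAbove i) + w)
  have hQ' : MeasurableSet Q' := MeasurableSet.univ_pi fun _ => measurableSet_Ioo
  have hvol : volume Q' = ENNReal.ofReal w ^ d := by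
    simp [Q', volume_pi_pi]
  rw [← hvol, ← setLIntegral_const, ← lintegral_indicator hQ']
  refine lintegral_mono fun q => ?_
  have hpre : ((fun x : ℝ => (x, q)) ⁻¹'
      ((MeasurableEquiv.piFinSuccAbove (fun _ : Fin (d + 1) => ℝ) j).symm ⁻¹' A)) =
      {s : ℝ | j.insertNth (α := fun _ => ℝ) s q ∈ A} := by
    ext s; simp [MeasurableEquiv.piFinSuccAbove, Fin.insertNthEquiv]
  simp only [hpre]
  by_cases hq : q ∈ Q'
  · rw [indicator_of_mem hq]
    have := hm (j.insertNth (α := fun _ => ℝ) (a j + w / 2) q) (by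
      intro i _
      refine Fin.succAboveCases j ?_ (fun i => ?_) i
      · simp only [Fin.insertNth_apply_same, mem_Ioo]; constructor <;> linarith
      · simpa using hq i (mem_univ _))
    simpa only [Fin.update_insertNth] using this
  · rw [indicator_of_notMem hq]
    have : {s : ℝ | j.insertNth (α := fun _ => ℝ) s q ∈ A} = ∅ := by
      ext s
      simp only [mem_ofPred_eq, mem_empty_iff_false, iff_false]
      intro hs
      refine hq fun i _ => ?_
      have := hAQ hs (j.succAbove i) (mem_univ _)
      simpa using this
    rw [this]; simp

/-- The point that has the first `m` coordinates of `z` and the remaining ones of `y`. -/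
def splice {d : ℕ} (y z : Fin d → ℝ) (m : ℕ) : Fin d → ℝ :=
  fun i => if i.val < m then z i else y i

lemma splice_succ {d : ℕ} (y z : Fin d → ℝ) (j : Fin d) :
    splice y z (j + 1) = Function.update (splice y z j) j (z j) := by
  ext i
  by_cases h : i = j
  · subst h; simp [splice]
  · have : (i : ℕ) ≠ j := fun h' => h (Fin.ext h')
    rw [Function.update_of_ne h]
    simp only [splice]
    congr 1
    simp only [eq_iff_iff]; omega

lemma splice_update {d : ℕ} (y z : Fin d → ℝ) (j : Fin d) (s : ℝ) :
    splice y (Function.update z j s) j = splice y z j := by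
  ext i
  simp only [splice]
  split_ifs with h
  · rw [Function.update_of_ne]; rintro rfl; exact lt_irrefl _ h
  · rfl

lemma continuous_splice {d : ℕ} (y : Fin d → ℝ) (m : ℕ) :
    Continuous fun z => splice y z m := by
  refine continuous_pi fun i => ?_
  simp only [splice]
  split_ifs
  exacts [continuous_apply i, continuous_const]

/-- Sublevel set estimate on a cube: it follows from the estimates on the lines parallel to the
coordinate axes, with the exponent divided by the dimension. -/
lemma volume_sublevel_cube_le {d : ℕ} {w : ℝ} (hw : 0 < w) (a : Fin (d + 1) → ℝ)
    {g : (Fin (d + 1) → ℝ) → ℝ}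
    (hg : ContinuousOn g (univ.pi fun i => Ioo (a i) (a i + w))) {K α : ℝ}
    (hslice : ∀ j, ∀ p ∈ univ.pi fun i => Ioo (a i) (a i + w), ∀ ε M : ℝ, 0 < ε → 0 < M →
      M ≤ |g p| → volume {s ∈ Ioo (a j) (a j + w) | |g (Function.update p j s)| < ε} ≤
        ENNReal.ofReal (K * (ε / M) ^ α * w))
    {ε M : ℝ} (hε : 0 < ε) (hM : 0 < M) {y : Fin (d + 1) → ℝ}
    (hy : y ∈ univ.pi fun i => Ioo (a i) (a i + w)) (hMy : M ≤ |g y|) :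
    volume {z ∈ univ.pi fun i => Ioo (a i) (a i + w) | |g z| < ε} ≤
      ENNReal.ofReal
        ((d + 1 : ℕ) * (K * ((ε / M) ^ ((1 : ℝ) / (d + 1 : ℕ))) ^ α * w ^ (d + 1))) := by
  set Q : Set (Fin (d + 1) → ℝ) := univ.pi fun i => Ioo (a i) (a i + w) with hQ
  have hQo : IsOpen Q := isOpen_set_pi finite_univ fun _ _ => isOpen_Ioo
  set lam : ℝ := (ε / M) ^ ((1 : ℝ) / (d + 1 : ℕ)) with hlam
  have hlam0 : 0 < lam := by positivity
  have hlamd : lam ^ (d + 1) = ε / M := by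
    rw [hlam, one_div, Real.rpow_inv_natCast_pow (by positivity) (by omega)]
  have hspl : ∀ z ∈ Q, ∀ m, splice y z m ∈ Q := by
    intro z hz m i hi
    simp only [splice]
    split_ifs
    exacts [hz i hi, hy i hi]
  -- `E j` is the set of `z` for which `|g|` drops below `M lam ^ (j + 1)` at step `j` of the path
  -- from `y` to `z`
  set E : Fin (d + 1) → Set (Fin (d + 1) → ℝ) := fun j =>
    {z ∈ Q | |g (splice y z (j + 1))| < M * lam ^ ((j : ℕ) + 1)} \
      {z ∈ Q | |g (splice y z j)| < M * lam ^ (j : ℕ)} with hE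
  have hopen : ∀ (m : ℕ) (c : ℝ), IsOpen {z ∈ Q | |g (splice y z m)| < c} := by
    intro m c
    have hc : ContinuousOn (fun z => |g (splice y z m)|) Q :=
      (hg.comp (continuous_splice y m).continuousOn fun z hz => hspl z hz m).abs
    exact hc.isOpen_inter_preimage hQo (isOpen_Iio (a := c))
  have hcover : {z ∈ Q | |g z| < ε} ⊆ ⋃ j, E j := by
    rintro z ⟨hz, hgz⟩
    have hlast : ¬ M * lam ^ (d + 1) ≤ |g (splice y z (d + 1))| := by
      have : splice y z (d + 1) = z := by ext i; exact if_pos i.isLt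
      rw [this, hlamd, mul_div_cancel₀ _ hM.ne']
      exact not_le.2 hgz
    have hfirst : M * lam ^ 0 ≤ |g (splice y z 0)| := by
      have : splice y z 0 = y := by ext i; simp [splice]
      rw [this]; simpa using hMy
    by_contra hno
    simp only [hE, mem_iUnion, Set.mem_sdiff, mem_ofPred_eq, not_exists, not_and, hz,
      true_and] at hno
    have hall : ∀ m ≤ d + 1, M * lam ^ m ≤ |g (splice y z m)| := by
      intro m
      induction m with
      | zero => exact fun _ => hfirst
      | succ m ih =>
        intro hm
        by_contra hlt
        exact hno ⟨m, by omega⟩ (not_le.1 hlt) (not_lt.2 (ih (by omega)))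
    exact hlast (hall _ le_rfl)
  have hEj : ∀ j, volume (E j) ≤ ENNReal.ofReal (K * lam ^ α * w) * ENNReal.ofReal w ^ d := by
    intro j
    refine volume_le_of_sections hw a ((hopen _ _).measurableSet.diff (hopen _ _).measurableSet)
      (fun z hz => hz.1.1) j _ fun p hp => ?_
    by_cases hbig : M * lam ^ (j : ℕ) ≤ |g (splice y p j)|
    · refine (measure_mono ?_).trans ((hslice j (splice y p j) (hspl p hp j)
        (M * lam ^ ((j : ℕ) + 1)) (M * lam ^ (j : ℕ)) (by positivity) (by positivity)
        hbig).trans_eq ?_)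
      · intro s hs
        have h1 := hs.1.2
        rw [splice_succ, splice_update, Function.update_self] at h1
        refine ⟨?_, h1⟩
        have := hs.1.1 j (mem_univ _)
        simpa using this
      · congr 4
        rw [pow_succ]; field_simp
    · have : {s : ℝ | Function.update p j s ∈ E j} = ∅ := by
        ext s
        simp only [mem_ofPred_eq, mem_empty_iff_false, iff_false]
        intro hs
        refine hs.2 ⟨hs.1.1, ?_⟩
        rw [splice_update]; exact not_le.1 hbig
      rw [this]; simp
  calc volume {z ∈ Q | |g z| < ε} ≤ volume (⋃ j, E j) := measure_mono hcover
    _ ≤ ∑ j, volume (E j) := measure_iUnion_fintype_le _ _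
    _ ≤ ∑ _j : Fin (d + 1), ENNReal.ofReal (K * lam ^ α * w) * ENNReal.ofReal w ^ d :=
      Finset.sum_le_sum fun j _ => hEj j
    _ = _ := by
      rw [Finset.sum_const, Finset.card_univ, Fintype.card_fin, nsmul_eq_mul,
        ← ENNReal.ofReal_pow hw.le, ← ENNReal.ofReal_mul' (by positivity),
        ← ENNReal.ofReal_natCast, ← ENNReal.ofReal_mul (by positivity)]
      congr 1; ring

/-- A nonnegative function `g` is `(C, α)`-good near `x₀`, at scale `R`: on every ball whose centre
`c` and radius `s` satisfy `dist c x₀ + s ≤ R`, the set where `g < ε` has relative measure at most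
`C (ε / M) ^ α` as soon as `g` takes a value `≥ M` on the ball. The condition on `c` and `s` (rather
than the inclusion of the ball in the `R`-ball about `x₀`) makes the quantification over balls
purely numerical. -/
def GoodNear {d : ℕ} (x₀ : EuclideanSpace ℝ (Fin d)) (R C α : ℝ)
    (g : EuclideanSpace ℝ (Fin d) → ℝ) : Prop :=
  ∀ c s, 0 < s → dist c x₀ + s ≤ R → ∀ ε M : ℝ, 0 < ε → 0 < M → ∀ y ∈ Metric.ball c s, M ≤ g y →
    volume {x ∈ Metric.ball c s | g x < ε} ≤
      ENNReal.ofReal (C * (ε / M) ^ α) * volume (Metric.ball c s)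

lemma GoodNear.mono {d : ℕ} {x₀ : EuclideanSpace ℝ (Fin d)} {R R' C C' α : ℝ}
    {g : EuclideanSpace ℝ (Fin d) → ℝ} (h : GoodNear x₀ R C α g) (hR : R' ≤ R) (hC : C ≤ C') :
    GoodNear x₀ R' C' α g := by
  intro c s hs hcs ε M hε hM y hy hMy
  refine (h c s hs (hcs.trans hR) ε M hε hM y hy hMy).trans ?_
  gcongr

/-- A smaller exponent is allowed, since the estimate is trivial for `ε ≥ M`. -/
lemma GoodNear.mono_exponent {d : ℕ} {x₀ : EuclideanSpace ℝ (Fin d)} {R C α β : ℝ}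
    {g : EuclideanSpace ℝ (Fin d) → ℝ} (h : GoodNear x₀ R C α g) (hC : 1 ≤ C) (hβ0 : 0 ≤ β)
    (hβ : β ≤ α) : GoodNear x₀ R C β g := by
  intro c s hs hcs ε M hε hM y hy hMy
  have hpos : 0 < ε / M := by positivity
  rcases le_total (ε / M) 1 with h1 | h1
  · refine (h c s hs hcs ε M hε hM y hy hMy).trans ?_
    gcongr ENNReal.ofReal (C * ?_) * _
    exact Real.rpow_le_rpow_of_exponent_ge hpos h1 hβ
  · refine (measure_mono (t := Metric.ball c s) fun x hx => hx.1).trans ?_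
    refine le_mul_of_one_le_left' ?_
    rw [ENNReal.one_le_ofReal]
    exact one_le_mul_of_one_le_of_one_le hC (Real.one_le_rpow h1 hβ0)

lemma goodNear_const {d : ℕ} (x₀ : EuclideanSpace ℝ (Fin d)) (R : ℝ) {C α : ℝ} (hC : 1 ≤ C)
    (hα : 0 ≤ α) (b : ℝ) : GoodNear x₀ R C α fun _ => b := by
  intro c s hs hcs ε M hε hM y hy hMy
  rcases le_or_gt ε b with h | h
  · simp [not_lt.2 h]
  · refine (measure_mono (t := Metric.ball c s) fun x hx => hx.1).trans ?_
    refine le_mul_of_one_le_left' ?_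
    rw [ENNReal.one_le_ofReal]
    refine one_le_mul_of_one_le_of_one_le hC (Real.one_le_rpow ?_ hα)
    rw [one_le_div hM]; linarith

lemma GoodNear.const_mul {d : ℕ} {x₀ : EuclideanSpace ℝ (Fin d)} {R C α : ℝ}
    {g : EuclideanSpace ℝ (Fin d) → ℝ} (h : GoodNear x₀ R C α g) {b : ℝ} (hb : 0 < b) :
    GoodNear x₀ R C α fun x => b * g x := by
  intro c s hs hcs ε M hε hM y hy hMy
  have := h c s hs hcs (ε / b) (M / b) (by positivity) (by positivity) y hy
    (by rw [div_le_iff₀ hb]; linarith)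
  have h2 : ε / b / (M / b) = ε / M := by field_simp
  rw [h2] at this
  simpa only [lt_div_iff₀' hb] using this

/-- The maximum of finitely many good functions is good. -/
lemma goodNear_norm_pi {d : ℕ} {ι : Type*} [Fintype ι] {x₀ : EuclideanSpace ℝ (Fin d)}
    {R C α : ℝ} {G : EuclideanSpace ℝ (Fin d) → ι → ℝ}
    (h : ∀ i, GoodNear x₀ R C α fun x => |G x i|) : GoodNear x₀ R C α fun x => ‖G x‖ := by
  intro c s hs hcs ε M hε hM y hy hMy
  obtain ⟨i, hi⟩ : ∃ i, M ≤ |G y i| := by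
    by_contra! hcon
    exact absurd hMy (not_le.2 ((pi_norm_lt_iff hM).2 hcon))
  refine (measure_mono ?_).trans (h i c s hs hcs ε M hε hM y hy hi)
  exact fun x hx => ⟨hx.1, (norm_le_pi_norm (G x) i).trans_lt hx.2⟩

/-- The image of Lebesgue measure under a linear isomorphism `ℝ^d ≃ EuclideanSpace ℝ (Fin d)` is a
multiple of Lebesgue measure. -/
lemma exists_volume_image_eq {d : ℕ} (L : (Fin d → ℝ) ≃L[ℝ] EuclideanSpace ℝ (Fin d)) :
    ∃ κ : ENNReal, κ ≠ ⊤ ∧ ∀ T : Set (Fin d → ℝ), volume (L '' T) = κ * volume T := by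
  obtain ⟨κ, h⟩ : ∃ κ : NNReal, Measure.map L.symm
      (volume : Measure (EuclideanSpace ℝ (Fin d))) = κ • volume :=
    ⟨_, Measure.isAddLeftInvariant_eq_smul _ _⟩
  refine ⟨κ, ENNReal.coe_ne_top, fun T => ?_⟩
  have h1 : Measure.map L.symm (volume : Measure (EuclideanSpace ℝ (Fin d))) T =
      volume (L.symm ⁻¹' T) :=
    L.symm.toHomeomorph.toMeasurableEquiv.map_apply T
  have h2 : L '' T = L.symm ⁻¹' T := L.toEquiv.image_eq_preimage_symm T
  rw [h2, ← h1, h]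
  rfl

/-- A function whose `k`-th derivatives in the directions of some basis of `ℝ^d` are bounded and
bounded away from zero is good with exponent `1 / (d k)`. The basis consists of the
`L (Pi.single i 1)`, and `G i j` is the `j`-th derivative in the direction of its `i`-th member. -/
lemma exists_goodNear_of_directional {d k : ℕ} (hk : 1 ≤ k)
    (L : (Fin (d + 1) → ℝ) ≃L[ℝ] EuclideanSpace ℝ (Fin (d + 1))) {A₁ A₂ : ℝ} (hA₁ : 0 < A₁) :
    ∃ C θ : ℝ, 0 < θ ∧ ∀ (x₀ : EuclideanSpace ℝ (Fin (d + 1))) (R : ℝ)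
      (g : EuclideanSpace ℝ (Fin (d + 1)) → ℝ)
      (G : Fin (d + 1) → ℕ → EuclideanSpace ℝ (Fin (d + 1)) → ℝ), 0 < R →
      (∀ i, G i 0 = g) → ContinuousOn g (Metric.ball x₀ R) →
      (∀ i, ∀ j < k, ∀ x ∈ Metric.ball x₀ R,
        HasDerivAt (fun s : ℝ => G i j (x + s • L (Pi.single i 1))) (G i (j + 1) x) 0) →
      (∀ i, ∀ x ∈ Metric.ball x₀ R, A₁ ≤ |G i k x| ∧ |G i k x| ≤ A₂) →
      GoodNear x₀ (θ * R) C ((1 : ℝ) / ((d + 1 : ℕ) * k)) fun x => |g x| := by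
  obtain ⟨κ, hκ, hvol⟩ := exists_volume_image_eq L
  set K₁ : ℝ := 4 * k * ((k + 1) * (A₂ / A₁ + 1)) with hK₁
  obtain ⟨N, hN0, hN⟩ := (L : (Fin (d + 1) → ℝ) →L[ℝ] EuclideanSpace ℝ (Fin (d + 1))).bound
  obtain ⟨K, hK0, hK⟩ := (L.symm : EuclideanSpace ℝ (Fin (d + 1)) →L[ℝ] (Fin (d + 1) → ℝ)).bound
  simp only [ContinuousLinearEquiv.coe_coe] at hN hK
  set T := N * K + 1 with hT
  have hT1 : 1 ≤ T := by rw [hT]; nlinarith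
  set V : ENNReal := volume (Metric.ball (0 : EuclideanSpace ℝ (Fin (d + 1))) 1) with hV
  have hV0 : V ≠ 0 := (Metric.measure_ball_pos _ _ one_pos).ne'
  have hVt : V ≠ ⊤ := measure_ball_lt_top.ne
  refine ⟨κ.toReal * ((d + 1 : ℕ) * (K₁ * (2 * K) ^ (d + 1))) / V.toReal, T⁻¹, by positivity, ?_⟩
  intro x₀ R g G hR hG0 hgc hGd hGk c s hs hcs ε M hε hM y hy hMy
  set a : Fin (d + 1) → ℝ := fun i => L.symm c i - K * s with ha
  set w := 2 * K * s with hw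
  have hw0 : 0 < w := by positivity
  set Q : Set (Fin (d + 1) → ℝ) := univ.pi fun i => Ioo (a i) (a i + w) with hQ
  have hmemQ : ∀ z, z ∈ Q ↔ ‖z - L.symm c‖ < K * s := by
    intro z
    rw [pi_norm_lt_iff (by positivity)]
    simp only [hQ, Set.mem_pi, mem_univ, true_imp_iff, mem_Ioo, Pi.sub_apply,
      Real.norm_eq_abs, abs_lt]
    refine forall_congr' fun i => ?_
    simp only [ha, hw]
    constructor <;> rintro ⟨h1, h2⟩ <;> constructor <;> linarith
  have hLQ : ∀ z ∈ Q, L z ∈ Metric.ball x₀ R := by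
    intro z hz
    rw [hmemQ] at hz
    have h2 : dist (L z) c < T * s := by
      have h1 := hN (z - L.symm c)
      rw [map_sub, L.apply_symm_apply, ← dist_eq_norm] at h1
      rw [hT]
      nlinarith [mul_lt_mul_of_pos_left hz hN0]
    have h3 : T * (dist c x₀ + s) ≤ R := by
      calc T * (dist c x₀ + s) ≤ T * (T⁻¹ * R) := by gcongr
        _ = R := by field_simp
    rw [Metric.mem_ball]
    have := dist_triangle (L z) c x₀
    nlinarith [dist_nonneg (x := c) (y := x₀)]
  have hballQ : ∀ x ∈ Metric.ball c s, L.symm x ∈ Q := by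
    intro x hx
    rw [hmemQ, ← map_sub]
    refine (hK (x - c)).trans_lt ?_
    rw [Metric.mem_ball, dist_eq_norm] at hx
    gcongr
  have hcube := volume_sublevel_cube_le (K := K₁) (α := (1 : ℝ) / k) hw0 a (g := fun z => g (L z))
    (hgc.comp L.continuous.continuousOn hLQ) (by
      intro j p hp ε M hε hM hMp
      have hupd : ∀ s ∈ Ioo (a j) (a j + w), Function.update p j s ∈ Q := by
        intro s hs i _
        by_cases hij : i = j
        · subst hij; simpa using hs
        · simpa [Function.update_of_ne hij] using hp i (mem_univ _)
      have := volume_sublevel_Ioo_le hk (a := a j) (b := a j + w)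
        (F := fun m s => G j m (L (Function.update p j s))) (A₂ := A₂)
        (by
          intro m hm s hs
          have hd := hGd j m hm _ (hLQ _ (hupd s hs))
          have hd' : HasDerivAt (fun h : ℝ => G j m (L (Function.update p j s) +
            h • L (Pi.single j 1))) (G j (m + 1) (L (Function.update p j s))) (s - s) := by
            rwa [sub_self]
          refine (hd'.comp_sub_const s s).congr_of_eventuallyEq (Filter.Eventually.of_forall ?_)
          intro h
          simp only
          rw [← map_smul, ← map_add]
          congr 2
          ext i
          by_cases hij : i = j
          · subst hij; simp
          · simp [hij])
        hA₁ (fun s hs => hGk j _ (hLQ _ (hupd s hs))) hε hM (y := p j) (hp j (mem_univ _))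
        (by simpa [hG0] using hMp)
      simpa [hG0, hK₁] using this)
    hε hM (hballQ y hy) (by simpa using hMy)
  have hsub : {x ∈ Metric.ball c s | |g x| < ε} ⊆ L '' {z ∈ Q | |g (L z)| < ε} := by
    intro x hx
    exact ⟨L.symm x, ⟨hballQ x hx.1, by simpa using hx.2⟩, by simp⟩
  refine (measure_mono hsub).trans ?_
  rw [hvol, Measure.addHaar_ball _ _ hs.le, finrank_euclideanSpace_fin, ← hV]
  refine (mul_le_mul_right hcube κ).trans_eq ?_
  rw [← ENNReal.ofReal_toReal hκ, ← ENNReal.ofReal_toReal hVt,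
    ENNReal.toReal_ofReal (by positivity),
    ENNReal.toReal_ofReal (by positivity),
    ← ENNReal.ofReal_mul (by positivity), ← ENNReal.ofReal_mul (by positivity),
    ← ENNReal.ofReal_mul' (by positivity)]
  congr 1
  have hVr : 0 < V.toReal := ENNReal.toReal_pos hV0 hVt
  rw [← Real.rpow_mul (by positivity), one_div_mul_one_div, hw]
  field_simp
  ring

/-! ### Combinations of the components of a nondegenerate map -/

section Symmetry

variable {E F : Type*} [NormedAddCommGroup E] [NormedSpace ℝ E] [NormedAddCommGroup F]
  [NormedSpace ℝ F]

lemma fderiv_iteratedFDeriv_apply {j : ℕ} {f : E → F} {x : E}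
    (h : DifferentiableAt ℝ (iteratedFDeriv ℝ j f) x) (v : E) (m : Fin j → E) :
    fderiv ℝ (fun y => iteratedFDeriv ℝ j f y m) x v = fderiv ℝ (iteratedFDeriv ℝ j f) x v m := by
  have h1 := (ContinuousMultilinearMap.apply ℝ (fun _ : Fin j => E) F m).hasFDerivAt.comp x
    h.hasFDerivAt
  have h2 : fderiv ℝ (fun y => iteratedFDeriv ℝ j f y m) x = _ := h1.fderiv
  rw [h2]; rfl

/-- The `k`-th derivative of a `C^k` function is symmetric. -/
theorem iteratedFDeriv_comp_perm_of_contDiffAt {f : E → F} {k : ℕ} {x : E}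
    (hf : ContDiffAt ℝ k f x) (v : Fin k → E) (σ : Equiv.Perm (Fin k)) :
    iteratedFDeriv ℝ k f x (v ∘ σ) = iteratedFDeriv ℝ k f x v := by
  induction k generalizing x with
  | zero => rw [Subsingleton.elim (v ∘ σ) v]
  | succ k ih =>
    have hσ : σ ∈ Submonoid.closure
        (Set.range fun i : Fin k ↦ Equiv.swap i.castSucc i.succ) := by
      rw [Equiv.Perm.mclosure_swap_castSucc_succ]; trivial
    induction hσ using Submonoid.closure_induction generalizing v with
    | one => rfl
    | mul σ τ _ _ h1 h2 =>
      rw [← h1 v, ← h2 (v ∘ σ)]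
      rfl
    | mem σ hσ =>
      obtain ⟨i, rfl⟩ := hσ
      have hdiff : DifferentiableAt ℝ (iteratedFDeriv ℝ k f) x :=
        hf.differentiableAt_iteratedFDeriv (by exact_mod_cast k.lt_succ_self)
      simp only
      rw [iteratedFDeriv_succ_apply_left, iteratedFDeriv_succ_apply_left,
        ← fderiv_iteratedFDeriv_apply hdiff, ← fderiv_iteratedFDeriv_apply hdiff]
      obtain ⟨m, rfl⟩ : ∃ m, k = m + 1 := ⟨k - 1, by have := i.pos; omega⟩
      refine Fin.cases ?_ (fun i => ?_) i
      · -- the swap of the first two arguments: symmetry of second derivatives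
        have hev : ∀ᶠ y in 𝓝 x, DifferentiableAt ℝ (iteratedFDeriv ℝ m f) y := by
          filter_upwards [hf.eventually (by simp)] with y hy
          exact hy.differentiableAt_iteratedFDeriv (by exact_mod_cast (by omega : m < m + 1 + 1))
        have hC2 : ContDiffAt ℝ 2 (iteratedFDeriv ℝ m f) x :=
          hf.iteratedFDeriv_right (by norm_cast; omega)
        have hsymm := hC2.isSymmSndFDerivAt (by simp)
        have hd2 : DifferentiableAt ℝ (fderiv ℝ (iteratedFDeriv ℝ m f)) x :=
          (hC2.fderiv_right (m := 1) (by norm_num)).differentiableAt (by simp)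
        have key : ∀ u : Fin (m + 1 + 1) → E,
            fderiv ℝ (fun y => iteratedFDeriv ℝ (m + 1) f y (Fin.tail u)) x (u 0) =
            fderiv ℝ (fderiv ℝ (iteratedFDeriv ℝ m f)) x (u 0) (u 1) (Fin.tail (Fin.tail u)) := by
          intro u
          have h0 := hd2.hasFDerivAt.clm_apply (hasFDerivAt_const (u 1) x)
          have h1 : HasFDerivAt (fun y => iteratedFDeriv ℝ (m + 1) f y (Fin.tail u)) _ x :=
            (ContinuousMultilinearMap.apply ℝ (fun _ : Fin m => E) F
              (Fin.tail (Fin.tail u))).hasFDerivAt.comp x h0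
          rw [h1.fderiv]
          simp
        rw [key, key]
        have h0 : (v ∘ (Equiv.swap (0 : Fin (m + 1)).castSucc (0 : Fin (m + 1)).succ)) 0 = v 1 := by
          simp
        have h1 : (v ∘ (Equiv.swap (0 : Fin (m + 1)).castSucc (0 : Fin (m + 1)).succ)) 1 = v 0 := by
          simp
        have h2 : Fin.tail (Fin.tail
            (v ∘ (Equiv.swap (0 : Fin (m + 1)).castSucc (0 : Fin (m + 1)).succ))) =
            Fin.tail (Fin.tail v) := by
          ext j
          simp only [Fin.tail, Function.comp]
          rw [Equiv.swap_apply_of_ne_of_ne]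
          · simp
          · simp [Fin.ext_iff]
        rw [h0, h1, h2, hsymm.eq]
      · -- a swap of later arguments: differentiate the symmetry of the lower derivative
        have h0 : (v ∘ (Equiv.swap i.succ.castSucc i.succ.succ)) 0 = v 0 := by
          simp only [Function.comp]
          rw [Equiv.swap_apply_of_ne_of_ne]
          · simp [Fin.ext_iff]
          · simp [Fin.ext_iff]
        have h1 : Fin.tail (v ∘ (Equiv.swap i.succ.castSucc i.succ.succ)) =
            Fin.tail v ∘ Equiv.swap i.castSucc i.succ := by
          ext j
          simp only [Fin.tail, Function.comp]
          congr 1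
          rw [← Fin.succ_castSucc]
          exact ((Fin.succ_injective _).swap_apply _ _ _)
        rw [h0, h1]
        congr 1
        refine congrArg (fun L : E →L[ℝ] F => L) (Filter.EventuallyEq.fderiv_eq ?_)
        filter_upwards [hf.eventually (by simp)] with y hy
        exact ih (hy.of_le (by exact_mod_cast Nat.le_succ _)) _ _

/-- Polarization: a symmetric multilinear form that vanishes on the diagonal is zero. -/
lemma eq_zero_of_diagonal_eq_zero {k : ℕ} (T : E [×k]→L[ℝ] ℝ)
    (hT : ∀ (v : Fin k → E) (σ : Equiv.Perm (Fin k)), T (v ∘ σ) = T v)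
    (h0 : ∀ u : E, T (fun _ => u) = 0) (v : Fin k → E) : T v = 0 := by
  have h := T.iteratedFDeriv_comp_diagonal 0 v
  simp only [h0] at h
  have h1 : iteratedFDeriv ℝ k (fun _ : E => (0 : ℝ)) 0 v = 0 := by simp
  have h2 : ∀ σ : Equiv.Perm (Fin k), T (fun i => v (σ i)) = T v := hT v
  simp only [h1, h2] at h
  rw [Finset.sum_const, Finset.card_univ,
    nsmul_eq_mul] at h
  rcases mul_eq_zero.1 h.symm with h | h
  · exact absurd h (by simp [Fintype.card_ne_zero])
  · exact h

lemma hasDerivAt_iteratedFDeriv_line {j : ℕ} {f : E → F} {x : E}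
    (h : DifferentiableAt ℝ (iteratedFDeriv ℝ j f) x) (u : E) :
    HasDerivAt (fun s : ℝ => iteratedFDeriv ℝ j f (x + s • u) (fun _ => u))
      (iteratedFDeriv ℝ (j + 1) f x (fun _ => u)) 0 := by
  have hl : HasDerivAt (fun s : ℝ => x + s • u) u 0 := by
    simpa using ((hasDerivAt_id (0 : ℝ)).smul_const u).const_add x
  have hd : HasFDerivAt (iteratedFDeriv ℝ j f) (fderiv ℝ (iteratedFDeriv ℝ j f) x)
      (x + (0 : ℝ) • u) := by simpa using h.hasFDerivAt
  have h1 := hd.comp_hasDerivAt (0 : ℝ) hl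
  exact (ContinuousMultilinearMap.apply ℝ (fun _ : Fin j => E) F (fun _ => u)).hasFDerivAt
    |>.comp_hasDerivAt (0 : ℝ) h1

end Symmetry

/-- A nonempty open subset of `ℝ^d` contains a basis. -/
lemma exists_linearEquiv_single_mem {d : ℕ} {S : Set (EuclideanSpace ℝ (Fin d))} (hS : IsOpen S)
    (hne : S.Nonempty) : ∃ L : (Fin d → ℝ) ≃L[ℝ] EuclideanSpace ℝ (Fin d),
      ∀ i, L (Pi.single i 1) ∈ S := by
  have htop : Submodule.span ℝ S = ⊤ := by
    refine Submodule.eq_top_of_nonempty_interior' _ (hne.mono ?_)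
    exact (hS.subset_interior_iff).2 Submodule.subset_span
  obtain ⟨v, hvS, hspan, hli⟩ := Submodule.exists_fun_fin_finrank_span_eq ℝ S
  have hfr : Module.finrank ℝ (Submodule.span ℝ S) = d := by
    rw [htop, finrank_top, finrank_euclideanSpace_fin]
  let b := (Module.Basis.mk hli (by rw [hspan, htop])).reindex (finCongr hfr)
  refine ⟨b.equivFun.symm.toContinuousLinearEquiv, fun i => ?_⟩
  have : b.equivFun.symm.toContinuousLinearEquiv (Pi.single i 1) = b i := by
    simp [Module.Basis.equivFun_symm_apply, Pi.single_apply]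
  rw [this]
  simpa [b] using hvS _

section Nondegenerate

variable {d n l : ℕ} {U : Set (EuclideanSpace ℝ (Fin d))}
  {f : EuclideanSpace ℝ (Fin d) → (Fin n → ℝ)} {x₀ : EuclideanSpace ℝ (Fin d)}

/-- The linear form `y ↦ ∑ c_i y_i`. -/
noncomputable def dotL (c : Fin n → ℝ) : (Fin n → ℝ) →L[ℝ] ℝ :=
  LinearMap.toContinuousLinearMap (dotProductBilin ℝ ℝ c)

@[simp] lemma dotL_apply (c y : Fin n → ℝ) : dotL c y = c ⬝ᵥ y := rfl

lemma exists_partialDeriv_ne (hspan : SpannedByPartials l f x₀) {c : Fin n → ℝ} (hc : c ≠ 0) :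
    ∃ k, 1 ≤ k ∧ k ≤ l ∧ ∃ v : Fin k → EuclideanSpace ℝ (Fin d),
      c ⬝ᵥ iteratedFDeriv ℝ k f x₀ v ≠ 0 := by
  by_contra! hcon
  refine hc ?_
  have hker : (⊤ : Submodule ℝ (Fin n → ℝ)) ≤ LinearMap.ker (dotL c).toLinearMap := by
    rw [← hspan, Submodule.span_le]
    rintro _ ⟨k, hk1, hk2, i, rfl⟩
    exact hcon k hk1 hk2 _
  have h2 : c ⬝ᵥ c = 0 := hker (x := c) trivial
  exact dotProduct_self_eq_zero.1 h2

/-- Some pure directional derivative of a nontrivial combination of the components is nonzero. -/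
lemma exists_pure_deriv_ne (hU : IsOpen U) (hf : ContDiffOn ℝ (l : WithTop ℕ∞) f U) (hx₀ : x₀ ∈ U)
    (hspan : SpannedByPartials l f x₀) {c : Fin n → ℝ} (hc : c ≠ 0) :
    ∃ k, 1 ≤ k ∧ k ≤ l ∧ ∃ u, c ⬝ᵥ iteratedFDeriv ℝ k f x₀ (fun _ => u) ≠ 0 := by
  obtain ⟨k, hk1, hkl, v, hv⟩ := exists_partialDeriv_ne hspan hc
  refine ⟨k, hk1, hkl, ?_⟩
  by_contra! hcon
  have hfk : ContDiffAt ℝ k f x₀ :=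
    (hf.contDiffAt (hU.mem_nhds hx₀)).of_le (by exact_mod_cast hkl)
  refine hv (eq_zero_of_diagonal_eq_zero
    ((dotL c).compContinuousMultilinearMap (iteratedFDeriv ℝ k f x₀)) (fun w σ => ?_) hcon v)
  simp [iteratedFDeriv_comp_perm_of_contDiffAt hfk]

end Nondegenerate

section Affine

variable {d n l : ℕ} {U : Set (EuclideanSpace ℝ (Fin (d + 1)))}
  {f : EuclideanSpace ℝ (Fin (d + 1)) → (Fin n → ℝ)} {x₀ : EuclideanSpace ℝ (Fin (d + 1))}

/-- The combinations `c₀ + ∑ c_i f_i`, for `c` near a given nonzero vector, are uniformly good. -/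
lemma exists_goodNear_of_nhds (hU : IsOpen U) (hf : ContDiffOn ℝ (l : WithTop ℕ∞) f U)
    (hx₀ : x₀ ∈ U) (hspan : SpannedByPartials l f x₀) {c : Fin n → ℝ} (hc : c ≠ 0) :
    ∃ N ∈ 𝓝 c, ∃ R C : ℝ, 0 < R ∧ 1 ≤ C ∧ ∀ c' ∈ N, ∀ c₀ : ℝ,
      GoodNear x₀ R C ((1 : ℝ) / ((d + 1 : ℕ) * l)) fun x => |c₀ + c' ⬝ᵥ f x| := by
  obtain ⟨k, hk1, hkl, u, hu⟩ := exists_pure_deriv_ne hU hf hx₀ hspan hc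
  have hfU : ∀ x ∈ U, ContDiffAt ℝ l f x := fun x hx => hf.contDiffAt (hU.mem_nhds hx)
  have hopen : IsOpen {u | c ⬝ᵥ iteratedFDeriv ℝ k f x₀ (fun _ => u) ≠ 0} := by
    refine isOpen_ne_fun ?_ continuous_const
    have h1 : Continuous fun u : EuclideanSpace ℝ (Fin (d + 1)) =>
        iteratedFDeriv ℝ k f x₀ (fun _ => u) :=
      (iteratedFDeriv ℝ k f x₀).cont.comp (continuous_pi fun _ => continuous_id)
    exact (dotL c).continuous.comp h1
  obtain ⟨L, hL⟩ := exists_linearEquiv_single_mem hopen ⟨u, hu⟩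
  set H : Fin (d + 1) → (Fin n → ℝ) × EuclideanSpace ℝ (Fin (d + 1)) → ℝ := fun i p =>
    |p.1 ⬝ᵥ iteratedFDeriv ℝ k f p.2 (fun _ => L (Pi.single i 1))| with hH
  have hHc : ∀ i, ContinuousAt (H i) (c, x₀) := by
    intro i
    have h1 : ContinuousAt (fun x => iteratedFDeriv ℝ k f x (fun _ => L (Pi.single i 1))) x₀ :=
      (ContinuousMultilinearMap.apply ℝ (fun _ : Fin k => EuclideanSpace ℝ (Fin (d + 1)))
        (Fin n → ℝ) (fun _ => L (Pi.single i 1))).continuous.continuousAt.comp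
        ((hfU x₀ hx₀).continuousAt_iteratedFDeriv (by exact_mod_cast hkl))
    have h2 : ContinuousAt (fun p : (Fin n → ℝ) × EuclideanSpace ℝ (Fin (d + 1)) =>
        iteratedFDeriv ℝ k f p.2 (fun _ => L (Pi.single i 1))) (c, x₀) :=
      ContinuousAt.comp (f := Prod.snd) (x := (c, x₀)) h1 continuousAt_snd
    refine ContinuousAt.abs ?_
    have h3 : Continuous fun q : (Fin n → ℝ) × (Fin n → ℝ) => q.1 ⬝ᵥ q.2 :=
      continuous_fst.dotProduct continuous_snd
    exact ContinuousAt.comp (g := fun q : (Fin n → ℝ) × (Fin n → ℝ) => q.1 ⬝ᵥ q.2)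
      h3.continuousAt (continuousAt_fst.prodMk h2)
  have hpos : ∀ i, 0 < H i (c, x₀) := fun i => abs_pos.2 (hL i)
  obtain ⟨A₁, hA₁, hA₁H⟩ : ∃ A₁ > 0, ∀ i, A₁ < H i (c, x₀) := by
    obtain ⟨i₀, hi₀⟩ := Finite.exists_min fun i => H i (c, x₀)
    exact ⟨H i₀ (c, x₀) / 2, half_pos (hpos _),
      fun i => (half_lt_self (hpos _)).trans_le (hi₀ i)⟩
  obtain ⟨A₂, hA₂H⟩ : ∃ A₂, ∀ i, H i (c, x₀) < A₂ := by
    obtain ⟨i₀, hi₀⟩ := Finite.exists_max fun i => H i (c, x₀)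
    exact ⟨H i₀ (c, x₀) + 1, fun i => (hi₀ i).trans_lt (lt_add_one _)⟩
  have hev : ∀ᶠ p in 𝓝 (c, x₀), ∀ i, A₁ < H i p ∧ H i p < A₂ :=
    eventually_all.2 fun i => ((hHc i).eventually (lt_mem_nhds (hA₁H i))).and
      ((hHc i).eventually (gt_mem_nhds (hA₂H i)))
  rw [nhds_prod_eq, eventually_prod_iff] at hev
  obtain ⟨pa, hpa, pb, hpb, hab⟩ := hev
  obtain ⟨R, hR, hRsub⟩ := Metric.mem_nhds_iff.1 (inter_mem hpb (hU.mem_nhds hx₀))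
  obtain ⟨C, θ, hθ, hgood⟩ := exists_goodNear_of_directional (A₂ := A₂) hk1 L hA₁
  refine ⟨{c' | pa c'}, hpa, θ * R, max C 1, by positivity, le_max_right _ _, ?_⟩
  intro c' hc' c₀
  have hg := hgood x₀ R (fun x => c₀ + c' ⬝ᵥ f x)
    (fun i j x => (if j = 0 then c₀ else 0) +
      c' ⬝ᵥ iteratedFDeriv ℝ j f x (fun _ => L (Pi.single i 1))) hR
    (fun i => by ext x; simp)
    (by
      have h1 : ContinuousOn f (Metric.ball x₀ R) := hf.continuousOn.mono fun x hx => (hRsub hx).2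
      exact continuousOn_const.add ((dotL c').continuous.comp_continuousOn h1))
    (fun i j hj x hx => by
      have hd := hasDerivAt_iteratedFDeriv_line
        ((hfU x (hRsub hx).2).differentiableAt_iteratedFDeriv
        (m := j) (by exact_mod_cast hj.trans_le hkl)) (L (Pi.single i 1))
      have := ((dotL c').hasFDerivAt.comp_hasDerivAt (0 : ℝ) hd).const_add
        (if j = 0 then c₀ else 0)
      simpa using this)
    (fun i x hx => by
      have := hab hc' (hRsub hx).1 i
      simp only [hH] at this
      simp only [show k ≠ 0 by omega, if_false, zero_add]
      exact ⟨this.1.le, this.2.le⟩)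
  refine (hg.mono le_rfl (le_max_left _ _)).mono_exponent (le_max_right _ _) (by positivity) ?_
  have : (0 : ℝ) < k := by exact_mod_cast hk1
  have hkl' : (k : ℝ) ≤ l := by exact_mod_cast hkl
  gcongr

/-- All the combinations `c₀ + ∑ c_i f_i` are uniformly good near `x₀`. -/
theorem exists_goodNear_affine (hU : IsOpen U) (hf : ContDiffOn ℝ (l : WithTop ℕ∞) f U)
    (hx₀ : x₀ ∈ U) (hspan : SpannedByPartials l f x₀) :
    ∃ R C : ℝ, 0 < R ∧ 1 ≤ C ∧ ∀ (c : Fin n → ℝ) (c₀ : ℝ),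
      GoodNear x₀ R C ((1 : ℝ) / ((d + 1 : ℕ) * l)) fun x => |c₀ + c ⬝ᵥ f x| := by
  obtain ⟨R, C, hR, hC, h⟩ := (isCompact_sphere (0 : Fin n → ℝ) 1).induction_on
    (p := fun N => ∃ R C : ℝ, 0 < R ∧ 1 ≤ C ∧ ∀ c ∈ N, ∀ c₀ : ℝ,
      GoodNear x₀ R C ((1 : ℝ) / ((d + 1 : ℕ) * l)) fun x => |c₀ + c ⬝ᵥ f x|)
    ⟨1, 1, one_pos, le_rfl, fun c hc => absurd hc (notMem_empty c)⟩
    (fun s t hst ⟨R, C, hR, hC, h⟩ => ⟨R, C, hR, hC, fun c hc => h c (hst hc)⟩)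
    (fun s t ⟨R, C, hR, hC, h⟩ ⟨R', C', hR', hC', h'⟩ =>
      ⟨min R R', max C C', lt_min hR hR', le_max_of_le_left hC, fun c hc c₀ => by
        rcases hc with hc | hc
        · exact (h c hc c₀).mono (min_le_left _ _) (le_max_left _ _)
        · exact (h' c hc c₀).mono (min_le_right _ _) (le_max_right _ _)⟩)
    (fun c hc => by
      have hc0 : c ≠ 0 := by
        rintro rfl
        simp at hc
      obtain ⟨N, hN, h⟩ := exists_goodNear_of_nhds hU hf hx₀ hspan hc0
      exact ⟨N, mem_nhdsWithin_of_mem_nhds hN, h⟩)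
  refine ⟨R, C, hR, hC, fun c c₀ => ?_⟩
  by_cases hc : c = 0
  · subst hc
    simpa using goodNear_const x₀ R hC (by positivity) |c₀|
  · have hn : 0 < ‖c‖ := norm_pos_iff.2 hc
    have h1 := (h (‖c‖⁻¹ • c) (by simp [norm_smul, hn.ne']) (‖c‖⁻¹ * c₀)).const_mul hn
    convert h1 using 2 with x
    rw [smul_dotProduct, smul_eq_mul, ← mul_add, abs_mul, abs_inv, abs_norm, ← mul_assoc,
      mul_inv_cancel₀ hn.ne', one_mul]

/-- The functions `1, f_1, …, f_n` are linearly independent on every ball about `x₀`, in a uniform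
sense. -/
theorem exists_lower_bound_affine (hU : IsOpen U) (hf : ContDiffOn ℝ (l : WithTop ℕ∞) f U)
    (hx₀ : x₀ ∈ U) (hspan : SpannedByPartials l f x₀) {r : ℝ} (hr : 0 < r) :
    ∃ ρ : ℝ, 0 < ρ ∧ ∀ (c₀ : ℝ) (c : Fin n → ℝ), 1 ≤ ‖(c₀, c)‖ →
      ∃ x ∈ Metric.ball x₀ r, ρ ≤ |c₀ + c ⬝ᵥ f x| := by
  obtain ⟨ρ, hρ, h⟩ := (isCompact_sphere (0 : ℝ × (Fin n → ℝ)) 1).induction_on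
    (p := fun N => ∃ ρ : ℝ, 0 < ρ ∧ ∀ q ∈ N, ∃ x ∈ Metric.ball x₀ r, ρ ≤ |q.1 + q.2 ⬝ᵥ f x|)
    ⟨1, one_pos, fun c hc => absurd hc (notMem_empty c)⟩
    (fun s t hst ⟨R, hR, h⟩ => ⟨R, hR, fun c hc => h c (hst hc)⟩)
    (fun s t ⟨R, hR, h⟩ ⟨R', hR', h'⟩ =>
      ⟨min R R', lt_min hR hR', fun c hc => by
        rcases hc with hc | hc
        · obtain ⟨x, hx, hh⟩ := h c hc
          exact ⟨x, hx, (min_le_left _ _).trans hh⟩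
        · obtain ⟨x, hx, hh⟩ := h' c hc
          exact ⟨x, hx, (min_le_right _ _).trans hh⟩⟩)
    (fun q hq => by
      obtain ⟨x, hx, hne⟩ : ∃ x ∈ Metric.ball x₀ r, q.1 + q.2 ⬝ᵥ f x ≠ 0 := by
        by_contra! hcon
        have hq2 : q.2 = 0 := by
          by_contra hq2
          obtain ⟨k, hk1, hkl, v, hv⟩ := exists_partialDeriv_ne hspan hq2
          have hk0 : k ≠ 0 := by omega
          have h1 : (dotL q.2 ∘ f) =ᶠ[𝓝 x₀] fun _ => -q.1 := by
            filter_upwards [Metric.ball_mem_nhds x₀ hr] with x hx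
            have := hcon x hx
            simp only [Function.comp, dotL_apply]; linarith
          have h2 := (dotL q.2).iteratedFDeriv_comp_left (hf.contDiffAt (hU.mem_nhds hx₀))
            (i := k) (by exact_mod_cast hkl)
          rw [(h1.iteratedFDeriv ℝ k).eq_of_nhds, iteratedFDeriv_const_of_ne hk0] at h2
          have h3 := congrArg (fun T => T v) h2
          simp at h3
          exact hv h3.symm
        have hq1 : q.1 = 0 := by simpa [hq2] using hcon x₀ (Metric.mem_ball_self hr)
        have : q = 0 := Prod.ext hq1 hq2
        simp [this] at hq
      refine ⟨{q' | |q.1 + q.2 ⬝ᵥ f x| / 2 < |q'.1 + q'.2 ⬝ᵥ f x|}, ?_, |q.1 + q.2 ⬝ᵥ f x| / 2,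
        half_pos (abs_pos.2 hne), fun q' hq' => ⟨x, hx, le_of_lt hq'⟩⟩
      refine mem_nhdsWithin_of_mem_nhds ?_
      have hcont : Continuous fun q' : ℝ × (Fin n → ℝ) => |q'.1 + q'.2 ⬝ᵥ f x| :=
        (continuous_fst.add (continuous_snd.dotProduct continuous_const)).abs
      exact hcont.continuousAt.eventually (lt_mem_nhds (half_lt_self (abs_pos.2 hne))))
  refine ⟨ρ, hρ, fun c₀ c hc => ?_⟩
  have hn : 0 < ‖(c₀, c)‖ := one_pos.trans_le hc
  obtain ⟨x, hx, hh⟩ := h (‖(c₀, c)‖⁻¹ • (c₀, c)) (by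
    rw [mem_sphere_zero_iff_norm, norm_smul, norm_inv, norm_norm, inv_mul_cancel₀ hn.ne'])
  refine ⟨x, hx, hh.trans ?_⟩
  simp only [Prod.smul_fst, Prod.smul_snd, smul_dotProduct, smul_eq_mul]
  rw [← mul_add, abs_mul, abs_inv, abs_norm]
  exact mul_le_of_le_one_left (abs_nonneg _) (inv_le_one_of_one_le₀ hc)

end Affine

/-! ### Nondivergence for partially ordered families of good functions -/

/-- A set covered by balls on each of which a subset `A` has relatively small measure meets `A` in a
small set (by the Vitali covering lemma). -/
lemma volume_le_of_local {d : ℕ} {c : EuclideanSpace ℝ (Fin d)} {r : ℝ}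
    {A : Set (EuclideanSpace ℝ (Fin d))} (hA : A ⊆ Metric.ball c r) (B : ENNReal)
    (h : ∀ x ∈ A, ∃ r', 0 < r' ∧ r' < 2 * r ∧
      volume (A ∩ Metric.ball x r') ≤ B * volume (Metric.ball x (2 * r'))) :
    volume A ≤ B * ENNReal.ofReal (24 ^ d) * volume (Metric.ball c r) := by
  choose! rad hrad0 hrad hvol using h
  obtain ⟨u, huA, hdisj, hcov⟩ := Vitali.exists_disjoint_subfamily_covering_enlargement_closedBall
    A id (fun x => rad x / 6) (2 * r) (fun x hx => by linarith [hrad x hx, hrad0 x hx]) 5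
    (by norm_num)
  have hcount : u.Countable := by
    refine hdisj.countable_of_nonempty_interior fun x hx => ?_
    refine ⟨x, ?_⟩
    refine Metric.ball_subset_interior_closedBall (Metric.mem_ball_self ?_)
    linarith [hrad0 x (huA hx)]
  have hsub : A ⊆ ⋃ b ∈ u, A ∩ Metric.ball b (rad b) := by
    intro x hx
    obtain ⟨b, hb, hxb⟩ := hcov x hx
    have h0 := hrad0 b (huA hb)
    have hx' := hxb (Metric.mem_closedBall_self (by linarith [hrad0 x hx]))
    simp only [id, Metric.mem_closedBall] at hx'
    refine mem_iUnion₂.2 ⟨b, hb, hx, ?_⟩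
    rw [Metric.mem_ball]; linarith
  by_cases hAe : A = ∅
  · simp [hAe]
  obtain ⟨x₁, hx₁⟩ := nonempty_iff_ne_empty.2 hAe
  have hr : 0 < r := by linarith [hrad0 x₁ hx₁, hrad x₁ hx₁]
  have hball : ∀ b ∈ u, volume (Metric.ball b (2 * rad b)) =
      ENNReal.ofReal (12 ^ d) * volume (Metric.closedBall b (rad b / 6)) := by
    intro b hb
    have h0 := hrad0 b (huA hb)
    rw [Measure.addHaar_ball_of_pos _ _ (by positivity),
      Measure.addHaar_closedBall _ _ (by positivity), finrank_euclideanSpace_fin, ← mul_assoc,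
      ← ENNReal.ofReal_mul (by positivity), ← mul_pow]
    congr 3; ring
  calc volume A ≤ volume (⋃ b ∈ u, A ∩ Metric.ball b (rad b)) := measure_mono hsub
    _ ≤ ∑' b : u, volume (A ∩ Metric.ball (b : EuclideanSpace ℝ (Fin d)) (rad b)) :=
      measure_biUnion_le _ hcount _
    _ ≤ ∑' b : u, B * ENNReal.ofReal (12 ^ d) *
          volume (Metric.closedBall (b : EuclideanSpace ℝ (Fin d)) (rad b / 6)) := by
      refine ENNReal.tsum_le_tsum fun b => ?_
      rw [mul_assoc, ← hball b b.2]
      exact hvol b (huA b.2)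
    _ = B * ENNReal.ofReal (12 ^ d) * volume (⋃ b ∈ u, Metric.closedBall b (rad b / 6)) := by
      have hdisj' : u.PairwiseDisjoint fun b => Metric.closedBall b (rad b / 6) := hdisj
      rw [ENNReal.tsum_mul_left, measure_biUnion hcount hdisj'
        fun b _ => Metric.isClosed_closedBall.measurableSet]
    _ ≤ B * ENNReal.ofReal (12 ^ d) * volume (Metric.ball c (2 * r)) := by
      gcongr
      refine iUnion₂_subset fun b hb x hx => ?_
      have h1 := hA (huA hb)
      rw [Metric.mem_ball] at h1 ⊢
      rw [Metric.mem_closedBall] at hx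
      linarith [dist_triangle x b c, hrad b (huA hb)]
    _ = B * ENNReal.ofReal (24 ^ d) * volume (Metric.ball c r) := by
      rw [Measure.addHaar_ball_mul_of_pos _ _ (by norm_num),
        Measure.addHaar_ball_center _ c r, finrank_euclideanSpace_fin, ← mul_assoc, mul_assoc B,
        ← ENNReal.ofReal_mul (by positivity), ← mul_pow]
      norm_num

/-- If some `ψ s` is `< ρ` at `x`, there is a nearly maximal ball around `x` on which some `ψ s` is
`< ρ`: on the ball of twice its radius, every `ψ s` takes a value `≥ ρ`. -/
lemma exists_radius {ι : Type*} {d : ℕ} {S : Set ι}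
    {ψ : ι → EuclideanSpace ℝ (Fin d) → ℝ} {ρ : ℝ}
    {c x : EuclideanSpace ℝ (Fin d)} {r : ℝ} (hx : x ∈ Metric.ball c r)
    (hsup : ∀ s ∈ S, ∃ z ∈ Metric.ball c r, ρ ≤ ψ s z)
    (hcont : ∀ s ∈ S, ContinuousAt (ψ s) x) (hlt : ∃ s ∈ S, ψ s x < ρ) :
    ∃ r', 0 < r' ∧ r' < 2 * r ∧ (∃ s ∈ S, ∀ z ∈ Metric.ball x r', ψ s z < ρ) ∧
      ∀ s ∈ S, ∃ z ∈ Metric.ball x (2 * r'), ρ ≤ ψ s z := by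
  set T : Set ℝ := {r' | 0 < r' ∧ ∃ s ∈ S, ∀ z ∈ Metric.ball x r', ψ s z < ρ} with hT
  have hne : T.Nonempty := by
    obtain ⟨s, hs, hsx⟩ := hlt
    obtain ⟨r', hr', h⟩ := Metric.eventually_nhds_iff_ball.1 ((hcont s hs).eventually
      (gt_mem_nhds hsx))
    exact ⟨r', hr', s, hs, h⟩
  have hbd : ∀ r' ∈ T, r' < 2 * r := by
    rintro r' ⟨-, s, hs, h⟩
    by_contra! hcon
    obtain ⟨z, hz, hzρ⟩ := hsup s hs
    refine absurd (h z ?_) (not_lt.2 hzρ)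
    rw [Metric.mem_ball] at hx hz ⊢
    have := dist_triangle_right z x c
    linarith
  have hbdd : BddAbove T := ⟨2 * r, fun r' hr' => (hbd r' hr').le⟩
  obtain ⟨r₀, hr₀⟩ := hne
  have hsup0 : 0 < sSup T := hr₀.1.trans_le (le_csSup hbdd hr₀)
  obtain ⟨r', hr', hlt'⟩ := exists_lt_of_lt_csSup ⟨r₀, hr₀⟩ (half_lt_self hsup0)
  refine ⟨r', hr'.1, hbd r' hr', hr'.2, fun s hs => ?_⟩
  by_contra! hcon
  have : 2 * r' ∈ T := ⟨by linarith [hr'.1], s, hs, hcon⟩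
  linarith [le_csSup hbdd this]

/-- A point `z` is marked, with respect to a family `ψ s`, `s ∈ S`, of functions indexed by a
partially ordered set, if there is a chain in `S` on which `ψ s z < ρ` and that cannot be extended
by an element with `ψ s z < ε`: every `s ∈ S` comparable with the whole chain (in particular every
member of the chain) has `ε ≤ ψ s z`. -/
def Marked {ι X : Type*} [PartialOrder ι] (S : Set ι) (ψ : ι → X → ℝ) (ε ρ : ℝ) (z : X) : Prop :=
  ∃ c : Finset ι, (c : Set ι) ⊆ S ∧ IsChain (· ≤ ·) (c : Set ι) ∧ (∀ s ∈ c, ψ s z < ρ) ∧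
    ∀ s ∈ S, (∀ t ∈ c, s ≤ t ∨ t ≤ s) → ε ≤ ψ s z

section

variable {ι : Type*} [PartialOrder ι] {d : ℕ} {S : Set ι}
  {ψ : ι → EuclideanSpace ℝ (Fin d) → ℝ} {ε ρ : ℝ}

lemma marked_of_forall_le {X : Type*} {ψ : ι → X → ℝ} {z : X} (hερ : ε ≤ ρ)
    (h : ∀ s ∈ S, ρ ≤ ψ s z) : Marked S ψ ε ρ z :=
  ⟨∅, by simp, by simp, by simp, fun s hs _ => hερ.trans (h s hs)⟩

/-- A marking of `z` for the elements comparable with `s` extends by `s` to a marking for `S`. -/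
lemma Marked.of_comparable {X : Type*} {ψ : ι → X → ℝ} {z : X} {s : ι} (hs : s ∈ S)
    (h : Marked {t ∈ S | t ≠ s ∧ (t ≤ s ∨ s ≤ t)} ψ ε ρ z) (h1 : ε ≤ ψ s z) (h2 : ψ s z < ρ) :
    Marked S ψ ε ρ z := by
  classical
  obtain ⟨c, hcS, hc, hcρ, hcε⟩ := h
  refine ⟨insert s c, ?_, ?_, ?_, ?_⟩
  · intro t ht
    rcases Finset.mem_insert.1 (Finset.mem_coe.1 ht) with rfl | ht
    exacts [hs, (hcS ht).1]
  · rw [Finset.coe_insert]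
    exact hc.insert fun t ht _ => (hcS ht).2.2.symm
  · intro t ht
    rcases Finset.mem_insert.1 ht with rfl | ht
    exacts [h2, hcρ t ht]
  · intro t ht hcomp
    by_cases hts : t = s
    · rw [hts]; exact h1
    · exact hcε t ⟨ht, hts, hcomp s (Finset.mem_insert_self _ _)⟩
        fun t' ht' => hcomp t' (Finset.mem_insert_of_mem ht')

/-- Quantitative nondivergence for a partially ordered family of good functions: if every `ψ s`
reaches the value `ρ` on a ball, then most points of the ball are marked. -/
theorem volume_not_marked_le {x₀ : EuclideanSpace ℝ (Fin d)} {R C α : ℝ} (hC : 0 ≤ C)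
    (hε : 0 < ε) (hερ : ε ≤ ρ) (k : ℕ) (S : Set ι)
    (hchain : ∀ t : Finset ι, (t : Set ι) ⊆ S → IsChain (· ≤ ·) (t : Set ι) → t.card ≤ k)
    (hgood : ∀ s ∈ S, GoodNear x₀ R C α (ψ s))
    (hcont : ∀ s ∈ S, ContinuousOn (ψ s) (Metric.ball x₀ R))
    (c : EuclideanSpace ℝ (Fin d)) (r : ℝ) (hr : 0 < r) (hcr : dist c x₀ + 5 ^ k * r ≤ R)
    (hsup : ∀ s ∈ S, ∃ z ∈ Metric.ball c r, ρ ≤ ψ s z) :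
    volume {z ∈ Metric.ball c r | ¬ Marked S ψ ε ρ z} ≤
      ENNReal.ofReal (k * (24 ^ d) ^ k * (C * (ε / ρ) ^ α)) * volume (Metric.ball c r) := by
  classical
  have hρ : 0 < ρ := hε.trans_le hερ
  induction k generalizing S c r with
  | zero =>
    have hS : ∀ s, s ∉ S := fun s hs => by
      have := hchain {s} (by simpa using hs) (by simp)
      simp at this
    have : {z ∈ Metric.ball c r | ¬ Marked S ψ ε ρ z} = ∅ := by
      ext z
      simp only [mem_ofPred_eq, mem_empty_iff_false, iff_false, not_and, not_not]
      exact fun _ => marked_of_forall_le hερ fun s hs => absurd hs (hS s)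
    rw [this]; simp
  | succ k ih =>
    set τ := C * (ε / ρ) ^ α with hτ
    have hτ0 : 0 ≤ τ := by positivity
    have h5 : (1 : ℝ) ≤ 5 ^ k := one_le_pow₀ (by norm_num)
    rw [pow_succ] at hcr
    refine (volume_le_of_local (fun z hz => hz.1)
      (ENNReal.ofReal (τ + k * (24 ^ d) ^ k * τ)) ?_).trans ?_
    · rintro x ⟨hx, hxm⟩
      have hlt : ∃ s ∈ S, ψ s x < ρ := by
        by_contra! hcon
        exact hxm (marked_of_forall_le hερ hcon)
      have hxc : dist x c < r := hx
      have hxx₀ : dist x x₀ < dist c x₀ + r := by linarith [dist_triangle x c x₀]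
      have hxR : x ∈ Metric.ball x₀ R := by
        rw [Metric.mem_ball]; nlinarith
      obtain ⟨r', hr'0, hr', ⟨s, hs, hsρ⟩, hsup'⟩ := exists_radius hx hsup
        (fun s hs => (hcont s hs).continuousAt (Metric.isOpen_ball.mem_nhds hxR)) hlt
      refine ⟨r', hr'0, hr', ?_⟩
      -- on `ball x r'`, where `ψ s < ρ`, a marking within the elements comparable with `s` suffices
      have hfit : dist x x₀ + 5 ^ k * (2 * r') ≤ R := by nlinarith
      set S' : Set ι := {t ∈ S | t ≠ s ∧ (t ≤ s ∨ s ≤ t)} with hS'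
      have hS'S : ∀ t ∈ S', t ∈ S := fun t ht => ht.1
      have hIH := ih S' (fun t ht htc => by
          have hst : s ∉ t := fun h => (ht h).2.1 rfl
          have := hchain (insert s t) (by
            rw [Finset.coe_insert]
            exact insert_subset hs fun a ha => (ht ha).1) (by
            rw [Finset.coe_insert]
            exact htc.insert fun b hb _ => (ht hb).2.2.symm)
          rw [Finset.card_insert_of_notMem hst] at this
          omega)
        (fun t ht => hgood t (hS'S t ht)) (fun t ht => hcont t (hS'S t ht)) x (2 * r')
        (by positivity) hfit (fun t ht => hsup' t (hS'S t ht))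
      obtain ⟨y, hy, hyρ⟩ := hsup' s hs
      have hgs := hgood s hs x (2 * r') (by positivity) (by nlinarith) ε ρ hε hρ y hy hyρ
      have hsub : {z ∈ Metric.ball c r | ¬ Marked S ψ ε ρ z} ∩ Metric.ball x r' ⊆
          {z ∈ Metric.ball x (2 * r') | ψ s z < ε} ∪
            {z ∈ Metric.ball x (2 * r') | ¬ Marked S' ψ ε ρ z} := by
        rintro z ⟨⟨-, hzm⟩, hz⟩
        have hz2 : z ∈ Metric.ball x (2 * r') := Metric.ball_subset_ball (by linarith) hz
        by_cases hzε : ψ s z < ε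
        · exact Or.inl ⟨hz2, hzε⟩
        · exact Or.inr ⟨hz2, fun hm => hzm (hm.of_comparable hs (not_lt.1 hzε) (hsρ z hz))⟩
      refine (measure_mono hsub).trans ((measure_union_le _ _).trans ?_)
      rw [ENNReal.ofReal_add hτ0 (by positivity), add_mul]
      exact add_le_add hgs hIH
    · rw [← ENNReal.ofReal_mul (by positivity)]
      gcongr ENNReal.ofReal ?_ * _
      have h24 : (1 : ℝ) ≤ (24 ^ d) ^ k := one_le_pow₀ (one_le_pow₀ (by norm_num))
      calc (τ + k * (24 ^ d) ^ k * τ) * 24 ^ d ≤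
            ((24 ^ d) ^ k * τ + k * (24 ^ d) ^ k * τ) * 24 ^ d := by
            gcongr
            exact le_mul_of_one_le_left hτ0 h24
        _ = _ := by push_cast; ring

end

/-! ### Covolumes of rational subspaces -/

/-- The linear map `v ↦ g_t u_y v` of `ℝ^{n+1}`. -/
noncomputable def flow {n : ℕ} (t y : Fin n → ℝ) : (Fin (n + 1) → ℝ) →ₗ[ℝ] (Fin (n + 1) → ℝ) :=
  (gMat t).mulVecLin ∘ₗ (uMat y).mulVecLin

lemma flow_zero {n : ℕ} (t y : Fin n → ℝ) (v : Fin (n + 1) → ℝ) :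
    flow t y v 0 = Real.exp (∑ i, t i) * (v 0 + ∑ i, y i * v i.succ) := by
  simp only [flow, LinearMap.comp_apply, Matrix.mulVecLin_apply, gMat, Matrix.mulVec_diagonal]
  simp [uMat, Matrix.mulVec, dotProduct, Fin.sum_univ_succ]

lemma flow_succ {n : ℕ} (t y : Fin n → ℝ) (v : Fin (n + 1) → ℝ) (i : Fin n) :
    flow t y v i.succ = Real.exp (-t i) * v i.succ := by
  simp only [flow, LinearMap.comp_apply, Matrix.mulVecLin_apply, gMat, Matrix.mulVec_diagonal]
  simp [uMat, Matrix.mulVec, dotProduct, Fin.sum_univ_succ, Matrix.one_apply]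

/-- The Plücker coordinates of a family of `j` vectors of `ℝ^m`: the `j × j` minors of the matrix
whose columns are the given vectors. The rows are chosen by an arbitrary function, so that every
minor occurs several times, up to sign, and zeros occur. -/
noncomputable def plucker {m j : ℕ} (v : Fin j → Fin m → ℝ) : (Fin j → Fin m) → ℝ :=
  fun I => (Matrix.of fun a c => v c (I a)).det

/-- An integer vector, as a real vector. -/
def intVec {m : ℕ} (z : Fin m → ℤ) : Fin m → ℝ := fun i => z i

/-- A basis of the subspace `W` of `ℝ^m` that consists of integer vectors. -/
def IsFrame {m j : ℕ} (W : Submodule ℝ (Fin m → ℝ)) (b : Fin j → Fin m → ℤ) : Prop :=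
  LinearIndependent ℝ (fun c => intVec (b c)) ∧
    Submodule.span ℝ (range fun c => intVec (b c)) = W

/-- A subspace of `ℝ^m` is rational if it has a basis of integer vectors. -/
def IsRational {m : ℕ} (W : Submodule ℝ (Fin m → ℝ)) : Prop :=
  ∃ (j : ℕ) (b : Fin j → Fin m → ℤ), IsFrame W b

/-- The covolume of the image under `A` of the lattice of integer points of a rational subspace `W`,
measured by the maximum norm of Plücker coordinates. It is defined as the infimum over all integer
bases of `W` (not only those that generate the lattice), which avoids choosing a basis of the
lattice. -/
noncomputable def covol {m : ℕ} (W : Submodule ℝ (Fin m → ℝ))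
    (A : (Fin m → ℝ) →ₗ[ℝ] (Fin m → ℝ)) : ℝ :=
  sInf {s | ∃ (j : ℕ) (b : Fin j → Fin m → ℤ), IsFrame W b ∧
    s = ‖plucker fun c => A (intVec (b c))‖}

section Frames

variable {m j : ℕ} {W : Submodule ℝ (Fin m → ℝ)}

lemma IsFrame.finrank_eq {b : Fin j → Fin m → ℤ} (hb : IsFrame W b) : Module.finrank ℝ W = j := by
  rw [← hb.2, finrank_span_eq_card hb.1, Fintype.card_fin]

/-- The Plücker coordinates of two bases of a subspace are proportional, by a factor that is not
affected by a linear map. -/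
lemma exists_plucker_eq_mul (v v' : Fin j → Fin m → ℝ)
    (h : ∀ c, v' c ∈ Submodule.span ℝ (range v)) :
    ∃ δ : ℝ, ∀ A : (Fin m → ℝ) →ₗ[ℝ] (Fin m → ℝ),
      plucker (fun c => A (v' c)) = δ • plucker fun c => A (v c) := by
  simp only [Submodule.mem_span_range_iff_exists_fun] at h
  choose P hP using h
  refine ⟨(Matrix.of fun e c => P c e).det, fun A => ?_⟩
  ext I
  simp only [plucker, Pi.smul_apply, smul_eq_mul]
  rw [mul_comm, ← Matrix.det_mul]
  congr 1
  ext a c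
  simp only [Matrix.of_apply, Matrix.mul_apply]
  rw [← hP c, map_sum, Finset.sum_apply]
  refine Finset.sum_congr rfl fun e _ => ?_
  rw [map_smul, Pi.smul_apply, smul_eq_mul, mul_comm]

/-- Linearly independent vectors have a nonzero Plücker coordinate. -/
lemma exists_plucker_ne_zero {v : Fin j → Fin m → ℝ} (hv : LinearIndependent ℝ v) :
    ∃ I, plucker v I ≠ 0 := by
  set M : Matrix (Fin m) (Fin j) ℝ := Matrix.of fun i c => v c i with hM
  have hrank : Module.finrank ℝ (Submodule.span ℝ (range M.row)) = j := by
    have h1 := M.rank_eq_finrank_span_row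
    have h2 : Mᵀ.rank = j := by
      have : LinearIndependent ℝ Mᵀ.row := hv
      simpa using this.rank_matrix
    rw [Matrix.rank_transpose] at h2
    exact h1.symm.trans h2
  obtain ⟨g, hg, -, hli⟩ := Submodule.exists_fun_fin_finrank_span_eq ℝ (range M.row)
  choose I hI using hg
  refine ⟨fun a => I (Fin.cast hrank.symm a), ?_⟩
  have hli' : LinearIndependent ℝ
      (Matrix.of fun a c => v c (I (Fin.cast hrank.symm a)) : Matrix (Fin j) (Fin j) ℝ).row := by
    have h3 := hli.comp (Fin.cast hrank.symm) (Fin.cast_injective _)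
    have h4 : (Matrix.of fun a c => v c (I (Fin.cast hrank.symm a)) :
        Matrix (Fin j) (Fin j) ℝ).row = g ∘ Fin.cast hrank.symm := by
      ext a c
      simp only [Function.comp, ← hI]
      rfl
    rw [h4]
    exact h3
  rw [Matrix.linearIndependent_rows_iff_isUnit, Matrix.isUnit_iff_isUnit_det] at hli'
  exact hli'.ne_zero

lemma injective_of_plucker_ne_zero {v : Fin j → Fin m → ℝ} {I : Fin j → Fin m}
    (h : plucker v I ≠ 0) : Function.Injective I := by
  intro a a' haa
  by_contra hne
  exact h (Matrix.det_zero_of_row_eq hne (by ext c; simp [haa]))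

lemma plucker_intVec (b : Fin j → Fin m → ℤ) (I : Fin j → Fin m) :
    plucker (fun c => intVec (b c)) I = ((Matrix.of fun a c => b c (I a)).det : ℤ) := by
  rw [Int.cast_det]
  rfl

/-- The sum of the absolute values of the Plücker coordinates of a family of integer vectors. -/
def frameSize (b : Fin j → Fin m → ℤ) : ℕ :=
  ∑ I : Fin j → Fin m, (Matrix.of fun a c => b c (I a)).det.natAbs

lemma cast_frameSize (b : Fin j → Fin m → ℤ) :
    (frameSize b : ℝ) = ∑ I, |plucker (fun c => intVec (b c)) I| := by
  simp [frameSize, plucker_intVec, Nat.cast_natAbs]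

/-- Among all integer bases of a rational subspace there is one that realizes the covolume, for all
linear maps simultaneously. -/
lemma IsRational.exists_frame (hW : IsRational W) :
    ∃ (j : ℕ) (b : Fin j → Fin m → ℤ), IsFrame W b ∧
      (∀ A, covol W A = ‖plucker fun c => A (intVec (b c))‖) := by
  obtain ⟨j, b₀, hb₀⟩ := hW
  obtain ⟨b, hb, hmin⟩ := WellFounded.has_min (measure (frameSize (m := m) (j := j))).wf
    {b | IsFrame W b} ⟨b₀, hb₀⟩
  have hmin : ∀ b' : Fin j → Fin m → ℤ, IsFrame W b' → frameSize b ≤ frameSize b' :=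
    fun b' hb' => not_lt.1 (hmin b' hb')
  have hb : IsFrame W b := hb
  refine ⟨j, b, hb, fun A => ?_⟩
  refine IsLeast.csInf_eq ⟨⟨j, b, hb, rfl⟩, ?_⟩
  rintro _ ⟨j', b', hb', rfl⟩
  obtain rfl : j' = j := hb'.finrank_eq.symm.trans hb.finrank_eq
  obtain ⟨δ, hδ⟩ := exists_plucker_eq_mul (fun c => intVec (b c)) (fun c => intVec (b' c))
    (fun c => by rw [hb.2, ← hb'.2]; exact Submodule.subset_span ⟨c, rfl⟩)
  have hpos : 0 < (frameSize b : ℝ) := by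
    rw [cast_frameSize]
    obtain ⟨I, hI⟩ := exists_plucker_ne_zero hb.1
    exact Finset.sum_pos' (fun _ _ => abs_nonneg _) ⟨I, Finset.mem_univ _, abs_pos.2 hI⟩
  have hsize : (frameSize b' : ℝ) = |δ| * frameSize b := by
    rw [cast_frameSize, cast_frameSize, Finset.mul_sum]
    refine Finset.sum_congr rfl fun I _ => ?_
    have := congrFun (hδ LinearMap.id) I
    simp only [LinearMap.id_apply, Pi.smul_apply, smul_eq_mul] at this
    rw [this, abs_mul]
  have hδ1 : 1 ≤ |δ| := by
    have : (frameSize b : ℝ) ≤ frameSize b' := by exact_mod_cast hmin b' hb'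
    rw [hsize] at this
    by_contra! hlt
    nlinarith
  rw [hδ, norm_smul, Real.norm_eq_abs]
  exact le_mul_of_one_le_left (norm_nonneg _) hδ1

lemma IsFrame.covol_le {b : Fin j → Fin m → ℤ} (hb : IsFrame W b)
    (A : (Fin m → ℝ) →ₗ[ℝ] (Fin m → ℝ)) : covol W A ≤ ‖plucker fun c => A (intVec (b c))‖ := by
  refine csInf_le ⟨0, ?_⟩ ⟨j, b, hb, rfl⟩
  rintro _ ⟨_, _, _, rfl⟩
  exact norm_nonneg _

lemma isFrame_cons {b : Fin j → Fin m → ℤ} (hb : IsFrame W b) {z : Fin m → ℤ}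
    (hz : intVec z ∉ W) :
    IsFrame (W ⊔ Submodule.span ℝ {intVec z}) (Fin.cons z b : Fin (j + 1) → Fin m → ℤ) := by
  have hcons : (fun c => intVec ((Fin.cons z b : Fin (j + 1) → Fin m → ℤ) c)) =
      Fin.cons (intVec z) (fun c => intVec (b c)) := by
    ext c i
    refine Fin.cases ?_ (fun c => ?_) c <;> simp
  rw [IsFrame, hcons]
  refine ⟨linearIndependent_finCons.2 ⟨hb.1, by rwa [hb.2]⟩, ?_⟩
  rw [Fin.range_cons, Submodule.span_insert, hb.2, sup_comm]

/-- Expansion of the minors along the first column. -/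
lemma norm_plucker_cons_le (u : Fin m → ℝ) (v : Fin j → Fin m → ℝ) :
    ‖plucker (Fin.cons u v : Fin (j + 1) → Fin m → ℝ)‖ ≤ (j + 1) * ‖plucker v‖ * ‖u‖ := by
  rw [pi_norm_le_iff_of_nonneg (by positivity)]
  intro I
  rw [plucker, Matrix.det_succ_column_zero]
  refine (norm_sum_le _ _).trans ((Finset.sum_le_card_nsmul _ _ (‖u‖ * ‖plucker v‖)
    fun i _ => ?_).trans_eq ?_)
  · rw [norm_mul, norm_mul, norm_pow, norm_neg, norm_one, one_pow, one_mul]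
    refine mul_le_mul ?_ ?_ (norm_nonneg _) (norm_nonneg _)
    · exact norm_le_pi_norm u (I i)
    · exact norm_le_pi_norm (plucker v) fun a => I (i.succAbove a)
  · rw [Finset.card_univ, Fintype.card_fin, nsmul_eq_mul]
    push_cast; ring

/-- Adjoining an integer vector multiplies the covolume by at most a multiple of its length. -/
lemma IsRational.covol_sup_span_le (hW : IsRational W) {z : Fin m → ℤ} (hz : intVec z ∉ W)
    (A : (Fin m → ℝ) →ₗ[ℝ] (Fin m → ℝ)) :
    IsRational (W ⊔ Submodule.span ℝ {intVec z}) ∧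
      covol (W ⊔ Submodule.span ℝ {intVec z}) A ≤
        (Module.finrank ℝ W + 1) * covol W A * ‖A (intVec z)‖ := by
  obtain ⟨j, b, hb, hcov⟩ := hW.exists_frame
  have hf := isFrame_cons hb hz
  refine ⟨⟨_, _, hf⟩, (hf.covol_le A).trans ?_⟩
  rw [hcov, hb.finrank_eq]
  have hcons : (fun c => A (intVec ((Fin.cons z b : Fin (j + 1) → Fin m → ℤ) c))) =
      Fin.cons (A (intVec z)) (fun c => A (intVec (b c))) := by
    ext c i
    refine Fin.cases ?_ (fun c => ?_) c <;> simp
  rw [hcons]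
  exact norm_plucker_cons_le _ _

lemma isFrame_bot : IsFrame (⊥ : Submodule ℝ (Fin m → ℝ)) (Fin.elim0 : Fin 0 → Fin m → ℤ) :=
  ⟨linearIndependent_empty_type, by simp⟩

lemma covol_bot_le (A : (Fin m → ℝ) →ₗ[ℝ] (Fin m → ℝ)) : covol ⊥ A ≤ 1 := by
  refine (isFrame_bot.covol_le A).trans ?_
  rw [pi_norm_le_iff_of_nonneg zero_le_one]
  intro I
  simp [plucker]

end Frames

/-- A chain of nonzero subspaces of `ℝ^m` has at most `m` members. -/
lemma card_le_of_isChain {m : ℕ} (t : Finset (Submodule ℝ (Fin m → ℝ))) (h0 : ∀ W ∈ t, W ≠ ⊥)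
    (ht : IsChain (· ≤ ·) (t : Set (Submodule ℝ (Fin m → ℝ)))) : t.card ≤ m := by
  have h := Finset.card_le_card_of_injOn (s := t) (t := Finset.Icc 1 m)
    (fun W => Module.finrank ℝ W) (fun W hW => by
      have h1 := Submodule.finrank_le W
      have h2 := Submodule.one_le_finrank_iff.2 (h0 W hW)
      rw [Module.finrank_fin_fun] at h1
      simp only [Finset.coe_Icc, mem_Icc]
      exact ⟨h2, h1⟩)
    (fun W hW W' hW' hfr => by
      rcases ht.total hW hW' with hle | hle
      · exact Submodule.eq_of_le_of_finrank_le hle hfr.ge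
      · exact (Submodule.eq_of_le_of_finrank_le hle hfr.le).symm)
  simpa using h

/-- If the covolumes at a linear map `A` are marked, then `A` maps no nonzero integer vector to a
vector of norm less than `ε`. A vector `w` is tested against the rational subspace spanned by `w`
and by the largest member of the marking chain that does not contain it. -/
lemma le_norm_of_marked {m : ℕ} {X : Type*} {A : X → (Fin m → ℝ) →ₗ[ℝ] (Fin m → ℝ)} {x : X}
    {ε ρ : ℝ} (hρ : m * ρ ≤ 1)
    (h : Marked {W : Submodule ℝ (Fin m → ℝ) | W ≠ ⊥ ∧ IsRational W}
      (fun W x => covol W (A x)) ε ρ x)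
    {w : Fin m → ℤ} (hw : w ≠ 0) : ε ≤ ‖A x (intVec w)‖ := by
  classical
  obtain ⟨c, hcS, hc, hcρ, hcε⟩ := h
  have hw0 : intVec w ≠ 0 := fun h0 => hw (by
    ext i; simpa [intVec] using congrFun h0 i)
  have hchain : IsChain (· ≤ ·)
      ((insert ⊥ c : Finset (Submodule ℝ (Fin m → ℝ))) : Set (Submodule ℝ (Fin m → ℝ))) := by
    rw [Finset.coe_insert]
    exact hc.insert fun t _ _ => Or.inl bot_le
  obtain ⟨N, hN⟩ := ((insert ⊥ c).filter fun W => intVec w ∉ W).exists_maximal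
    ⟨⊥, by simp [hw0]⟩
  obtain ⟨hNc, hwN⟩ := Finset.mem_filter.1 hN.1
  have hNrat : IsRational N := by
    rcases Finset.mem_insert.1 hNc with rfl | hNc
    exacts [⟨_, _, isFrame_bot⟩, (hcS hNc).2]
  obtain ⟨hrat, hle⟩ := hNrat.covol_sup_span_le hwN (A x)
  have hwmem : intVec w ∈ N ⊔ Submodule.span ℝ {intVec w} :=
    Submodule.mem_sup_right (Submodule.mem_span_singleton_self _)
  have hε := hcε (N ⊔ Submodule.span ℝ {intVec w})
    ⟨fun h0 => hw0 (by simpa [h0] using hwmem), hrat⟩ (fun t ht => by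
      have ht' : t ∈ insert ⊥ c := Finset.mem_insert_of_mem ht
      by_cases hwt : intVec w ∈ t
      · left
        refine sup_le ?_ (by simpa using hwt)
        rcases hchain.total hNc ht' with h | h
        · exact h
        · exact absurd (h hwt) hwN
      · right
        refine le_trans ?_ le_sup_left
        rcases hchain.total ht' hNc with h | h
        · exact h
        · exact hN.2 (Finset.mem_filter.2 ⟨ht', hwt⟩) h)
  refine hε.trans (hle.trans (mul_le_of_le_one_left (norm_nonneg _) ?_))
  rcases Finset.mem_insert.1 hNc with rfl | hNc
  · simpa using covol_bot_le (A x)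
  · have hlt : Module.finrank ℝ N + 1 ≤ m := by
      have : N ≠ ⊤ := fun h => hwN (by rw [h]; trivial)
      have := Submodule.finrank_lt this
      rw [Module.finrank_fin_fun] at this
      omega
    have hlt' : (Module.finrank ℝ N : ℝ) + 1 ≤ m := by exact_mod_cast hlt
    have h1 := hcρ N hNc
    calc ((Module.finrank ℝ N : ℝ) + 1) * covol N (A x) ≤ (Module.finrank ℝ N + 1) * ρ := by gcongr
      _ ≤ 1 := by
        rcases le_total 0 ρ with h0 | h0
        · exact (by gcongr : ((Module.finrank ℝ N : ℝ) + 1) * ρ ≤ m * ρ).trans hρ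
        · nlinarith [(Nat.cast_nonneg (Module.finrank ℝ N) : (0 : ℝ) ≤ _)]

section Minors

variable {n j : ℕ}

/-- The factor by which `g_t` scales the coordinate of index `i`, except that row `a₀` of a minor is
taken to be scaled by the expanding factor. -/
noncomputable def rowScale (t : Fin n → ℝ) (I : Fin j → Fin (n + 1)) (a₀ a : Fin j) : ℝ :=
  if a = a₀ then Real.exp (∑ i, t i) else Real.exp (-(Fin.cons 0 t : Fin (n + 1) → ℝ) (I a))

lemma rowScale_pos (t : Fin n → ℝ) (I : Fin j → Fin (n + 1)) (a₀ a : Fin j) :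
    0 < rowScale t I a₀ a := by
  rw [rowScale]; split_ifs <;> positivity

/-- A minor of `g_t u_y v` that involves the row `0` exactly once is, up to scaling, a combination
of `1, y_1, …, y_n` whose coefficients are minors of `v`. -/
lemma plucker_flow (t y : Fin n → ℝ) (v : Fin j → Fin (n + 1) → ℝ) (I : Fin j → Fin (n + 1))
    (a₀ : Fin j) (h0 : I a₀ = 0) (hne : ∀ a ≠ a₀, I a ≠ 0) :
    plucker (fun c => flow t y (v c)) I = (∏ a, rowScale t I a₀ a) *
      (plucker v I + (fun i : Fin n => plucker v (Function.update I a₀ i.succ)) ⬝ᵥ y) := by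
  set M : Matrix (Fin j) (Fin j) ℝ := Matrix.of fun a c => v c (I a) with hM
  have hrow : ∀ i : Fin (n + 1), (M.updateRow a₀ fun c => v c i).det =
      plucker v (Function.update I a₀ i) := by
    intro i
    rw [plucker]
    congr 1
    ext a c
    by_cases ha : a = a₀
    · subst ha; simp
    · simp [Matrix.updateRow_ne ha, Function.update_of_ne ha, hM]
  have hdet : (M.updateRow a₀ ((fun c => v c 0) +
      ∑ i : Fin n, y i • fun c => v c i.succ)).det =
      plucker v I + (fun i : Fin n => plucker v (Function.update I a₀ i.succ)) ⬝ᵥ y := by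
    rw [Matrix.det_updateRow_add, hrow, ← h0, Function.update_eq_self]
    congr 1
    have := (Matrix.detRowAlternating (n := Fin j) (R := ℝ)).toMultilinearMap.map_update_sum
      Finset.univ a₀ (fun i : Fin n => y i • fun c => v c i.succ) M
    refine this.trans ?_
    rw [dotProduct]
    refine Finset.sum_congr rfl fun i _ => ?_
    refine (Matrix.det_updateRow_smul M a₀ (y i) fun c => v c i.succ).trans ?_
    rw [hrow, mul_comm]
  rw [← hdet, ← Matrix.det_mul_column]
  rw [plucker]
  congr 1
  ext a c
  simp only [Matrix.of_apply]
  by_cases ha : a = a₀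
  · subst ha
    simp [h0, flow_zero, rowScale, Finset.sum_apply]
  · obtain ⟨i, hi⟩ := Fin.exists_succ_eq.2 (hne a ha)
    rw [Matrix.updateRow_ne ha]
    simp [← hi, flow_succ, rowScale, ha, hM]

/-- A minor that does not involve the row `0` does not depend on `y`. -/
lemma plucker_flow_eq_of_ne (t y y' : Fin n → ℝ) (v : Fin j → Fin (n + 1) → ℝ)
    (I : Fin j → Fin (n + 1)) (hne : ∀ a, I a ≠ 0) :
    plucker (fun c => flow t y (v c)) I = plucker (fun c => flow t y' (v c)) I := by
  simp only [plucker]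
  congr 1
  ext a c
  obtain ⟨i, hi⟩ := Fin.exists_succ_eq.2 (hne a)
  simp [← hi, flow_succ]

/-- The expansion of the row `0` outweighs the contraction of distinct other rows. -/
lemma one_le_prod_rowScale {t : Fin n → ℝ} (ht : ∀ i, 0 ≤ t i) {I : Fin j → Fin (n + 1)}
    (a₀ : Fin j) (hI : ∀ a ≠ a₀, ∀ a' ≠ a₀, I a = I a' → a = a') :
    1 ≤ ∏ a, rowScale t I a₀ a := by
  set τ : Fin (n + 1) → ℝ := Fin.cons 0 t with hτ
  have hτ0 : ∀ i, 0 ≤ τ i := fun i => by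
    refine Fin.cases ?_ (fun i => ?_) i <;> simp [hτ, ht]
  have hsum : ∑ a ∈ Finset.univ.erase a₀, τ (I a) ≤ ∑ i, t i := by
    have h1 : ∑ i, t i = ∑ i, τ i := by simp [hτ, Fin.sum_univ_succ]
    have h2 : ∑ a ∈ Finset.univ.erase a₀, τ (I a) =
        ∑ i ∈ (Finset.univ.erase a₀).image I, τ i := by
      refine (Finset.sum_image fun a ha a' ha' haa => hI a ?_ a' ?_ haa).symm
      · exact Finset.ne_of_mem_erase (Finset.mem_coe.1 ha)
      · exact Finset.ne_of_mem_erase (Finset.mem_coe.1 ha')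
    rw [h1, h2]
    exact Finset.sum_le_univ_sum_of_nonneg hτ0
  rw [← Finset.mul_prod_erase _ _ (Finset.mem_univ a₀)]
  have h3 : ∏ a ∈ Finset.univ.erase a₀, rowScale t I a₀ a =
      Real.exp (-∑ a ∈ Finset.univ.erase a₀, τ (I a)) := by
    rw [← Finset.sum_neg_distrib, Real.exp_sum]
    refine Finset.prod_congr rfl fun a ha => ?_
    rw [rowScale, if_neg (Finset.ne_of_mem_erase ha)]
  rw [h3, rowScale, if_pos rfl, ← Real.exp_add]
  exact Real.one_le_exp (by linarith)

lemma continuous_norm_plucker_flow (t : Fin n → ℝ) (v : Fin j → Fin (n + 1) → ℝ) :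
    Continuous fun y => ‖plucker fun c => flow t y (v c)‖ := by
  refine Continuous.norm (continuous_pi fun I => Continuous.matrix_det ?_)
  refine continuous_matrix fun a c => ?_
  simp only [Matrix.of_apply]
  refine Fin.cases (motive := fun i => Continuous fun y => flow t y (v c) i) ?_ (fun i => ?_) (I a)
  · simp only [flow_zero]
    fun_prop
  · simp only [flow_succ]
    exact continuous_const

end Minors

section Covolume

variable {d n : ℕ} {f : EuclideanSpace ℝ (Fin d) → (Fin n → ℝ)} {x₀ : EuclideanSpace ℝ (Fin d)}
  {W : Submodule ℝ (Fin (n + 1) → ℝ)}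

lemma continuousOn_covol (t : Fin n → ℝ) {s : Set (EuclideanSpace ℝ (Fin d))}
    (hf : ContinuousOn f s) (hW : IsRational W) :
    ContinuousOn (fun x => covol W (flow t (f x))) s := by
  obtain ⟨j, b, -, hcov⟩ := hW.exists_frame
  simp only [hcov]
  exact (continuous_norm_plucker_flow t _).comp_continuousOn hf

/-- The covolumes are good, if the combinations of `1, f_1, …, f_n` are. -/
lemma goodNear_covol {R C α : ℝ} (hC : 1 ≤ C) (hα : 0 ≤ α)
    (hgood : ∀ (c : Fin n → ℝ) (c₀ : ℝ), GoodNear x₀ R C α fun x => |c₀ + c ⬝ᵥ f x|)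
    (t : Fin n → ℝ) (hW : IsRational W) :
    GoodNear x₀ R C α fun x => covol W (flow t (f x)) := by
  obtain ⟨j, b, -, hcov⟩ := hW.exists_frame
  simp only [hcov]
  refine goodNear_norm_pi (G := fun x => plucker fun c => flow t (f x) (intVec (b c))) fun I => ?_
  by_cases h0 : ∃ a₀, I a₀ = 0
  · obtain ⟨a₀, h0⟩ := h0
    by_cases hne : ∀ a ≠ a₀, I a ≠ 0
    · simp only [plucker_flow _ _ _ I a₀ h0 hne, abs_mul]
      exact (hgood _ _).const_mul
        (abs_pos.2 (Finset.prod_pos fun a _ => rowScale_pos t I a₀ a).ne')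
    · push Not at hne
      obtain ⟨a, ha, ha0⟩ := hne
      have hz : ∀ x, plucker (fun c => flow t (f x) (intVec (b c))) I = 0 := fun x => by
        by_contra hx
        exact ha (injective_of_plucker_ne_zero hx (ha0.trans h0.symm))
      simp only [hz]
      exact goodNear_const x₀ R hC hα _
  · push Not at h0
    simp only [plucker_flow_eq_of_ne t _ 0 _ I h0]
    exact goodNear_const x₀ R hC hα _

/-- The covolume of a nonzero rational subspace somewhere exceeds the constant of linear
independence of `1, f_1, …, f_n`. -/
lemma exists_le_covol {s : Set (EuclideanSpace ℝ (Fin d))} {ρ : ℝ}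
    (hρ : ∀ (c₀ : ℝ) (c : Fin n → ℝ), 1 ≤ ‖(c₀, c)‖ → ∃ x ∈ s, ρ ≤ |c₀ + c ⬝ᵥ f x|)
    {t : Fin n → ℝ} (ht : ∀ i, 0 ≤ t i) (hW : IsRational W) (hW0 : W ≠ ⊥) :
    ∃ x ∈ s, ρ ≤ covol W (flow t (f x)) := by
  obtain ⟨j, b, hb, hcov⟩ := hW.exists_frame
  obtain ⟨I, hI⟩ := exists_plucker_ne_zero hb.1
  have hIinj := injective_of_plucker_ne_zero hI
  -- make row `a₀` the row `0`: the one that is so already, or else any row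
  obtain ⟨a₀, ha₀⟩ : ∃ a₀, ∀ a ≠ a₀, I a ≠ 0 := by
    by_cases h : ∃ a, I a = 0
    · obtain ⟨a₀, h⟩ := h
      exact ⟨a₀, fun a ha h' => ha (hIinj (h'.trans h.symm))⟩
    · push Not at h
      have hj : 0 < j := by
        rw [← hb.finrank_eq]
        exact Submodule.one_le_finrank_iff.2 hW0
      exact ⟨⟨0, hj⟩, fun a _ => h a⟩
  set I' := Function.update I a₀ 0 with hI'
  have hI'ne : ∀ a ≠ a₀, I' a = I a := fun a ha => Function.update_of_ne ha _ _
  set q : Fin (n + 1) → ℤ := fun i =>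
    (Matrix.of fun a c => b c (Function.update I a₀ i a)).det with hq
  have hqp : ∀ i, plucker (fun c => intVec (b c)) (Function.update I a₀ i) = q i :=
    fun i => plucker_intVec _ _
  have hqI : q (I a₀) ≠ 0 := by
    have := hqp (I a₀)
    rw [Function.update_eq_self] at this
    intro h
    rw [h, Int.cast_zero] at this
    exact hI this
  have hnorm : 1 ≤ ‖((q 0 : ℝ), fun i : Fin n => (q i.succ : ℝ))‖ := by
    have h1 : (1 : ℝ) ≤ |(q (I a₀) : ℝ)| := by exact_mod_cast Int.one_le_abs hqI
    refine h1.trans ?_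
    rcases Fin.eq_zero_or_eq_succ (I a₀) with h | ⟨i, h⟩
    · rw [h]
      exact le_max_left _ _
    · rw [h]
      exact (norm_le_pi_norm (fun i : Fin n => (q i.succ : ℝ)) i).trans (le_max_right _ _)
  obtain ⟨x, hx, hxρ⟩ := hρ _ _ hnorm
  refine ⟨x, hx, hxρ.trans ?_⟩
  rw [hcov]
  refine le_trans ?_ (norm_le_pi_norm (plucker fun c => flow t (f x) (intVec (b c))) I')
  rw [plucker_flow t (f x) _ I' a₀ (by simp [hI']) fun a ha => by rw [hI'ne a ha]; exact ha₀ a ha]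
  simp only [hI', Function.update_idem, hqp]
  rw [norm_mul, Real.norm_eq_abs, Real.norm_eq_abs]
  refine le_mul_of_one_le_left (abs_nonneg _) ((one_le_prod_rowScale ht a₀ ?_).trans
    (le_abs_self _))
  intro a ha a' ha' haa
  rw [← hI', hI'ne a ha, hI'ne a' ha'] at haa
  exact hIinj haa

end Covolume

/-- A lower bound for the images of the nonzero integer vectors is one for `δ`. -/
lemma le_delta {n : ℕ} {t y : Fin n → ℝ} {ε : ℝ}
    (h : ∀ w : Fin (n + 1) → ℤ, w ≠ 0 → ε ≤ ‖flow t y (intVec w)‖) :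
    ε ≤ delta (matAct (gMat t) (latticeOf y)) := by
  have hmem : ∀ v, v ∈ matAct (gMat t) (latticeOf y) ↔ ∃ w, flow t y (intVec w) = v := by
    intro v
    simp only [matAct, latticeOf, intLattice, AddSubgroup.mem_map, AddMonoidHom.mem_range]
    constructor
    · rintro ⟨_, ⟨_, ⟨w, rfl⟩, rfl⟩, rfl⟩
      exact ⟨w, rfl⟩
    · rintro ⟨w, rfl⟩
      exact ⟨_, ⟨_, ⟨w, rfl⟩, rfl⟩, rfl⟩
  refine le_csInf ?_ ?_
  · refine ⟨_, flow t y (intVec (Pi.single 0 1)), (hmem _).2 ⟨_, rfl⟩, fun h0 => ?_, rfl⟩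
    have := congrFun h0 0
    simp [flow_zero, intVec] at this
  · rintro _ ⟨v, hv, hv0, rfl⟩
    obtain ⟨w, rfl⟩ := (hmem v).1 hv
    refine h w ?_
    rintro rfl
    refine hv0 ?_
    have : intVec (0 : Fin (n + 1) → ℤ) = 0 := by ext i; simp [intVec]
    rw [this, map_zero]

end KM

theorem proposition2p3 (d n l : ℕ) (hd : 1 ≤ d) (hn : 1 ≤ n) (hl : 1 ≤ l)
    (U : Set (EuclideanSpace ℝ (Fin d))) (hU : IsOpen U)
    (f : EuclideanSpace ℝ (Fin d) → (Fin n → ℝ)) (hf : ContDiffOn ℝ (l : WithTop ℕ∞) f U)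
    (x₀ : EuclideanSpace ℝ (Fin d)) (hx₀ : x₀ ∈ U) (hspan : KM.SpannedByPartials l f x₀) :
    ∃ r : ℝ, 0 < r ∧ Metric.ball x₀ r ⊆ U ∧
      ∃ D ρ : ℝ, 0 < D ∧ 0 < ρ ∧
        ∀ t : Fin n → ℝ, (∀ i, 0 ≤ t i) → ∀ ε : ℝ, 0 < ε → ε ≤ ρ →
          MeasureTheory.volume
              {x ∈ Metric.ball x₀ r |
                KM.delta (KM.matAct (KM.gMat t) (KM.latticeOf (f x))) < ε} ≤
            ENNReal.ofReal (D * (ε / ρ) ^ ((1 : ℝ) / ((d : ℝ) * (l : ℝ)))) *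
              MeasureTheory.volume (Metric.ball x₀ r) := by
  obtain ⟨d, rfl⟩ : ∃ d', d = d' + 1 := ⟨d - 1, by omega⟩
  obtain ⟨R₁, C, hR₁, hC, hgood₁⟩ := KM.exists_goodNear_affine hU hf hx₀ hspan
  obtain ⟨R₂, hR₂, hR₂U⟩ := Metric.isOpen_iff.1 hU x₀ hx₀
  -- the induction on chains of length at most `n + 1` needs the functions to be good on a ball
  -- `5 ^ (n + 1)` times as large
  set R := min R₁ R₂ with hR
  have hR0 : 0 < R := lt_min hR₁ hR₂
  have hRU : Metric.ball x₀ R ⊆ U := (Metric.ball_subset_ball (min_le_right _ _)).trans hR₂U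
  have hgood : ∀ (c : Fin n → ℝ) (c₀ : ℝ),
      KM.GoodNear x₀ R C ((1 : ℝ) / ((d + 1 : ℕ) * l)) fun x => |c₀ + c ⬝ᵥ f x| :=
    fun c c₀ => (hgood₁ c c₀).mono (min_le_left _ _) le_rfl
  set r := R / 5 ^ (n + 1) with hr
  have hr0 : 0 < r := by positivity
  have hrR : r ≤ R := div_le_self hR0.le (one_le_pow₀ (by norm_num))
  obtain ⟨ρ₀, hρ₀, hlower⟩ := KM.exists_lower_bound_affine hU hf hx₀ hspan hr0
  -- `1 / (n + 1)` absorbs the number of terms in the expansion of a minor along a column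
  set ρ := min ρ₀ (1 / (n + 1 : ℕ)) with hρ
  have hρ0 : 0 < ρ := lt_min hρ₀ (by positivity)
  have hnρ : (n + 1 : ℕ) * ρ ≤ 1 := by
    calc ((n + 1 : ℕ) : ℝ) * ρ ≤ (n + 1 : ℕ) * (1 / (n + 1 : ℕ)) := by
          gcongr
          exact min_le_right _ _
      _ = 1 := by field_simp
  refine ⟨r, hr0, (Metric.ball_subset_ball hrR).trans hRU,
    (n + 1 : ℕ) * (24 ^ (d + 1)) ^ (n + 1) * C, ρ, by positivity, hρ0, ?_⟩
  intro t ht ε hε hερ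
  have hmain := KM.volume_not_marked_le (x₀ := x₀) (R := R) (C := C)
    (α := (1 : ℝ) / ((d + 1 : ℕ) * l)) (ψ := fun W x => KM.covol W (KM.flow t (f x)))
    (by linarith) hε hερ (n + 1)
    {W : Submodule ℝ (Fin (n + 1) → ℝ) | W ≠ ⊥ ∧ KM.IsRational W}
    (fun c hcS hc => KM.card_le_of_isChain c (fun W hW => (hcS hW).1) hc)
    (fun W hW => KM.goodNear_covol hC (by positivity) hgood t hW.2)
    (fun W hW => KM.continuousOn_covol t (hf.continuousOn.mono hRU) hW.2)
    x₀ r hr0 (by rw [dist_self, hr]; field_simp; simp)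
    (fun W hW => by
      obtain ⟨x, hx, h⟩ := KM.exists_le_covol hlower ht hW.2 hW.1
      exact ⟨x, hx, (min_le_left _ _).trans h⟩)
  rw [← mul_assoc] at hmain
  refine (MeasureTheory.measure_mono ?_).trans hmain
  rintro x ⟨hx, hxδ⟩
  exact ⟨hx, fun hm => absurd hxδ (not_lt.2 (KM.le_delta fun w hw =>
    KM.le_norm_of_marked hnρ hm hw))⟩
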